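/- \textbf{Setting.} Let $(\Omega,\mathcal F,P)$ be a probability space, let $\Omega_X\subseteq\mathbb R^p$ and $\Omega_Y\subseteq\mathbb R^q$, and let $X:\Omega\to\Omega_X$, $Y:\Omega\to\Omega_Y$ be Borel random vectors. Let $\mathcal H_X,\mathcal H_Y$ be the reproducing kernel Hilbert spaces of real positive definite kernels $\kappa_X$ on $\Omega_X$ and $\kappa_Y$ on $\Omega_Y$. Put $\mu_X=E\,\kappa_X(\cdot,X)$, $\mu_Y=E\,\kappa_Y(\cdot,Y)$, $\Sigma_{XX}=E[\{\kappa_X(\cdot,X)-\mu_X\}\otimes\{\kappa_X(\cdot,X)-\mu_X\}]$ and $\Sigma_{XY}=E[\{\kappa_X(\cdot,X)-\mu_X\}\otimes\{\kappa_Y(\cdot,Y)-\mu_Y\}]:\mathcal H_Y\to\mathcal H_X$, where $(a\otimes b)c=\langle b,c\rangle a$. Given i.i.d. copies $(X_1,Y_1),(X_2,Y_2),\dots$ of $(X,Y)$, let $\widehat\mu_X,\widehat\mu_Y,\widehat\Sigma_{XX},\widehat\Sigma_{XY}$ be the same objects with expectations replaced by averages over the first $n$ observations and $\mu_X,\mu_Y$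 replaced by $\widehat\mu_X,\widehat\mu_Y$. For a bounded operator $A$, the Moore--Penrose inverse $A^\dagger:\operatorname{ran}(A)\to\ker(A)^\perp$ is the inverse of the restriction of $A$ to $\ker(A)^\perp$, and $\Sigma_{XX}^{\dagger1/2}=(\Sigma_{XX}^{1/2})^\dagger$. \textbf{Assumptions.} (1) $\mathcal H_X$ is dense in $L_2(P_X)$ modulo constants: for every $f\in L_2(P_X)$ there are $f_n\in\mathcal H_X$ with $\operatorname{var}[f_n(X)-f(X)]\to0$; likewise for $\mathcal H_Y$ and $Y$. (2) $\kappa_X$ and $\kappa_Y$ are bounded and continuous. (3) $\operatorname{ran}(\Sigma_{XY})\subseteq\operatorname{ran}(\Sigma_{XX})$. (4) $R_{XY}=\Sigma_{XX}^\dagger\Sigma_{XY}$ is bounded. (5) The conditional distributions $P_{X|Y}(\cdot|y)$ are dominated by a $\sigma$-finite measure. (6) There are $f_1,\dots,f_d\in\mathcal H_X$ such that $Y$ and $X$ are conditionally independent given $f_1(X),\dots,f_d(X)$, and $\sigma\{f_1(X),\dots,f_d(X)\}\subseteq\sigma\{g_1(X),\dots,g_{d'}(X)\}$ for all $g_1,\dots,g_{d'}\in\mathcal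 H_X$ with the same property. (7) $R'_{XY}=\Sigma_{XX}^{\dagger1/2}\Sigma_{XY}$ has rank $d$. (8) The eigenvalues $\lambda_1\ge\lambda_2\ge\cdots$ of $\Sigma_{XX}$ satisfy $c\,j^{-\alpha}\le\lambda_j\le C j^{-\alpha}$ for all $j\ge1$, with some $\alpha>1$ and constants $c,C>0$. (9) For some $\beta>0$ there is a bounded linear operator $S_{XY}:\mathcal H_Y\to\mathcal H_X$ with $\Sigma_{XY}=\Sigma_{XX}^{1+\beta}S_{XY}$. \textbf{Theorem 2.} Under (1)--(9), let $\epsilon_n>0$ with $\epsilon_n\to0$, and let $\widehat R'_{XY}=(\widehat\Sigma_{XX}+\epsilon_nI)^{-1/2}\widehat\Sigma_{XY}$. Then $R'_{XY}$ is everywhere defined and bounded, and, with $\widetilde\beta=\beta+\tfrac12$, $$\|\widehat R'_{XY}-R'_{XY}\|_{\mathrm{OP}}=O_p\Big(n^{-1/2}\epsilon_n^{(\widetilde\beta\wedge1)-1}+\epsilon_n^{\widetilde\beta\wedge1}+n^{-1}\epsilon_n^{-1-1/(2\alpha)}+n^{-1/2}\epsilon_n^{-1/(2\alpha)}\Big)\qquad(n\to\infty).$$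 -/

import Mathlib

open MeasureTheory ProbabilityTheory Filter Topology InnerProductSpace

noncomputable section

namespace GSIR

/-! ### Operators on real Hilbert spaces -/

section Operators

variable {E F : Type*} [NormedAddCommGroup E] [InnerProductSpace ℝ E]
  [NormedAddCommGroup F] [InnerProductSpace ℝ F]

/-- `T` is the power `A ^ s` of a diagonalizable operator `A`: it acts as `μ ^ s` on the eigenspace
of `A` for `μ`. When the eigenvectors of `A` span a dense subspace (as they do if `A` is compact and
self-adjoint, or such an operator plus a multiple of the identity), at most one bounded operator
has this property. -/
def IsOpPow (A : E →L[ℝ] E) (s : ℝ) (T : E →L[ℝ] E) : Prop :=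
  ∀ (μ : ℝ) (v : E), A v = μ • v → T v = (μ ^ s) • v

open Classical in
/-- The power `A ^ s` of a diagonalizable operator with nonnegative eigenvalues. -/
def opPow (A : E →L[ℝ] E) (s : ℝ) : E →L[ℝ] E :=
  if h : ∃ T, IsOpPow A s T then h.choose else 0

/-- The Moore-Penrose inverse of `A`, with domain the range of `A`: the inverse of the restriction
of `A` to the orthogonal complement of its kernel. -/
def moorePenrose (A : E →L[ℝ] F) : F →ₗ.[ℝ] E :=
  ((A : E →ₗ[ℝ] F).toPMap ((A : E →ₗ[ℝ] F).ker)ᗮ).inverse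

/-- `R` is the bounded operator `A† B`; in particular `B` maps into the domain of `A†`. -/
def IsMPComp {G : Type*} [NormedAddCommGroup G] [InnerProductSpace ℝ G]
    (A : E →L[ℝ] F) (B : G →L[ℝ] F) (R : G →L[ℝ] E) : Prop :=
  ∀ g : G, (B g, R g) ∈ (moorePenrose A).graph

open Classical in
/-- The operator `A† B`, if it is everywhere defined and bounded (and `0` otherwise). -/
def mpComp {G : Type*} [NormedAddCommGroup G] [InnerProductSpace ℝ G]
    (A : E →L[ℝ] F) (B : G →L[ℝ] F) : G →L[ℝ] E :=
  if h : ∃ R, IsMPComp A B R then h.choose else 0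

/-- `A = ∑ⱼ lam j • (φ j ⊗ φ j)` with `φ` orthonormal and `lam 0 ≥ lam 1 ≥ …`. -/
def IsEigenSeq (A : E →L[ℝ] E) (lam : ℕ → ℝ) (φ : ℕ → E) : Prop :=
  Antitone lam ∧ Orthonormal ℝ φ ∧
    ∀ x, HasSum (fun j => (lam j * inner ℝ (φ j) x) • φ j) (A x)

/-- The ordered eigenvalues of `A` satisfy `lam_j ≍ j ^ (-α)` for `j = 1, 2, …`
(the `j`-th eigenvalue is `lam (j - 1)`). -/
def EigenDecay (A : E →L[ℝ] E) (α : ℝ) : Prop :=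
  ∃ (lam : ℕ → ℝ) (φ : ℕ → E), IsEigenSeq A lam φ ∧
    ∃ c C : ℝ, 0 < c ∧ 0 < C ∧ ∀ j : ℕ,
      c * ((j : ℝ) + 1) ^ (-α) ≤ lam j ∧ lam j ≤ C * ((j : ℝ) + 1) ^ (-α)

end Operators

/-! ### Reproducing kernels, covariance operators and their estimators -/

section Covariance

variable {S T : Type*}
variable (H : Type*) [NormedAddCommGroup H] [InnerProductSpace ℝ H] [CompleteSpace H]
  [RKHS ℝ H S ℝ]
variable (K : Type*) [NormedAddCommGroup K] [InnerProductSpace ℝ K] [CompleteSpace K]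
  [RKHS ℝ K T ℝ]

/-- The element `κ(·, x)` of the reproducing kernel Hilbert space `H`. -/
def feat (x : S) : H := RKHS.kerFun H x (1 : ℝ)

/-- The reproducing kernel `κ(x, y)` of `H`. -/
def kappa (x y : S) : ℝ := RKHS.kernel H x y (1 : ℝ)

/-- The reproducing kernel of `H` is bounded and (jointly) continuous. -/
def BoundedContinuousKernel [TopologicalSpace S] : Prop :=
  (∃ C : ℝ, ∀ x y : S, |kappa H x y| ≤ C) ∧ Continuous fun z : S × S => kappa H z.1 z.2

variable {Ω : Type*} [MeasurableSpace Ω] (P : Measure Ω)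

/-- The mean element `E κ(·, X)`. -/
def meanElt (X : Ω → S) : H := ∫ ω, feat H (X ω) ∂P

/-- The cross-covariance operator `E [(κ(·, X) - μ_X) ⊗ (κ(·, Y) - μ_Y)] : K → H`,
where `(a ⊗ b) c = ⟨b, c⟩ a`. -/
def crossCov (X : Ω → S) (Y : Ω → T) : K →L[ℝ] H :=
  ∫ ω, rankOne ℝ (feat H (X ω) - meanElt H P X) (feat K (Y ω) - meanElt K P Y) ∂P

/-- The sample mean element of the first `n` observations. -/
def meanHat (n : ℕ) (x : ℕ → S) : H := (n : ℝ)⁻¹ • ∑ i ∈ Finset.range n, feat H (x i)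

/-- The sample cross-covariance operator of the first `n` observations. -/
def crossCovHat (n : ℕ) (x : ℕ → S) (y : ℕ → T) : K →L[ℝ] H :=
  (n : ℝ)⁻¹ • ∑ i ∈ Finset.range n,
    rankOne ℝ (feat H (x i) - meanHat H n x) (feat K (y i) - meanHat K n y)

/-- The operator `R' = Σ_XX^{†1/2} Σ_XY`. -/
def regOp (X : Ω → S) (Y : Ω → T) : K →L[ℝ] H :=
  mpComp (opPow (crossCov H H P X X) (1 / 2)) (crossCov H K P X Y)

/-- The estimator `(Σ̂_XX + ε I)^{-1/2} Σ̂_XY` from the first `n` observations. -/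
def regOpHat (n : ℕ) (ε : ℝ) (x : ℕ → S) (y : ℕ → T) : K →L[ℝ] H :=
  opPow (crossCovHat H H n x x + ε • ContinuousLinearMap.id ℝ H) (-(1 / 2)) ∘L
    crossCovHat H K n x y

/-- `H` is dense in `L₂(P_X)` modulo constants. -/
def DenseModConst [MeasurableSpace S] (X : Ω → S) : Prop :=
  ∀ f : S → ℝ, Measurable f → MemLp (fun ω => f (X ω)) 2 P →
    ∃ u : ℕ → H, Tendsto (fun n => variance (fun ω => u n (X ω) - f (X ω)) P) atTop (𝓝 0)

/-- The σ-field `σ{f_1(X), …, f_d(X)}` on `Ω`. -/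
abbrev sigmaOf {H} [NormedAddCommGroup H] [InnerProductSpace ℝ H] [RKHS ℝ H S ℝ]
    (X : Ω → S) {d : ℕ} (f : Fin d → H) : MeasurableSpace Ω :=
  MeasurableSpace.comap (fun ω i => f i (X ω)) (inferInstance : MeasurableSpace (Fin d → ℝ))

/-- `Y` and `X` are conditionally independent given the sub-σ-field `m`. -/
def CondIndepGiven [MeasurableSpace S] [MeasurableSpace T] (m : MeasurableSpace Ω)
    (Y : Ω → T) (X : Ω → S) : Prop :=
  ∀ (B : Set T) (A : Set S), MeasurableSet B → MeasurableSet A →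
    P⟦Y ⁻¹' B ∩ X ⁻¹' A | m⟧ =ᵐ[P] P⟦Y ⁻¹' B | m⟧ * P⟦X ⁻¹' A | m⟧

/-- There are `f_1, …, f_d ∈ H` such that `Y` and `X` are conditionally independent given
`f_1(X), …, f_d(X)`, and `σ{f_1(X), …, f_d(X)}` is contained in every σ-field generated in the same
way. -/
def MinimalSDR [MeasurableSpace S] [MeasurableSpace T] (X : Ω → S) (Y : Ω → T) (d : ℕ) : Prop :=
  ∃ f : Fin d → H, CondIndepGiven P (sigmaOf X f) Y X ∧
    ∀ (d' : ℕ) (g : Fin d' → H), CondIndepGiven P (sigmaOf X g) Y X → sigmaOf X f ≤ sigmaOf X g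

end Covariance

/-- The conditional distributions of `X` given `Y = y` (determined for almost every `y`) are
dominated by one σ-finite measure. -/
def CondDominated {Ω T : Type*} [MeasurableSpace Ω] [MeasurableSpace T] (P : Measure Ω)
    [IsFiniteMeasure P] {p : ℕ} (X : Ω → EuclideanSpace ℝ (Fin p)) (Y : Ω → T) : Prop :=
  ∃ ν : Measure (EuclideanSpace ℝ (Fin p)), SigmaFinite ν ∧
    ∀ᵐ y ∂(P.map Y), condDistrib X Y P y ≪ ν

/-- `Z n = O_p(r n)` as `n → ∞`. -/
def IsBigOp {Ω : Type*} [MeasurableSpace Ω] (P : Measure Ω) (Z : ℕ → Ω → ℝ) (r : ℕ → ℝ) : Prop :=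
  ∀ η : ℝ, 0 < η → ∃ M : ℝ, 0 < M ∧
    ∀ᶠ n in atTop, P {ω | M * r n < |Z n ω|} ≤ ENNReal.ofReal η

end GSIR

end

/-!
Write `Σ = Σ_XX`, `A = Σ̂_XX + ε`, `B = Σ + ε`, `Σ_XY = Σ^{1+β} S`. All powers act diagonally in a
Hilbert basis of eigenvectors (`IsDiag.opPow`): for `Σ` an extension of the given eigenvectors
(`EigenDecay.exists_isDiag`), for `Σ̂_XX` one that comes from the spectral theorem in finite
dimension (`exists_isDiag_crossCovHat`). In particular `R' = Σ^{β+1/2} S` (`isMPComp_of_isDiag`),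
and the error splits as

`A^{-1/2} (Σ̂_XY - Σ_XY) + (A^{-1/2} - B^{-1/2}) Σ^{1+β} S + (B^{-1/2} Σ^{1+β} - Σ^{β+1/2}) S`.

The last term is a bias of order `ε ^ min (β + 1/2) 1` (`abs_regularization_bias_le`). The first
two are controlled by the Hilbert-Schmidt norms of `B^{-1/2} (Σ̂_XX - Σ)` and `B^{-1/2} (Σ̂_XY -
Σ_XY)`, both at most `δ`, as follows.

* `A^{-1/2}` is compared with `B^{-1/2}` without assuming that `Σ̂_XX - Σ` is small relative to
  `ε`: the norm `t` of `A^{-1/2} B^{1/2}` satisfies `t² ≤ 1 + t δ ε^{-1/2}`, hence `t ≤ 1 + δ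
  ε^{-1/2}` (`norm_invSqrt_comp_sqrt_le`). The first term is therefore at most `t δ`.
* On an eigenvector `φ` of `B` for `γ`, the vector `w = (A^{-1/2} - B^{-1/2}) φ` solves `(A^{1/2}
  + γ^{1/2}) w = -γ^{-1/2} A^{-1/2} (A - B) φ`, so `‖w‖ ≤ γ⁻¹ ‖A^{-1/2} (A - B) φ‖`
  (`norm_invSqrt_sub_apply_le`). Summing over the eigenbasis bounds the second term by a multiple
  of `t δ` (`norm_invSqrt_sub_comp_le`).

Since the squared norm of a centered mean of i.i.d. vectors has expectation `O(n⁻¹)`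
(`integral_norm_sq_mean_sub_le`), the expected squared Hilbert-Schmidt norms are of order `n⁻¹`
times the effective dimension `tr (Σ B⁻¹)`, which is `O(ε^{-1/α})` by the eigenvalue decay
(`exists_sum_div_add_le`). By Markov's inequality `δ = O_p(n^{-1/2} ε^{-1/(2α)})`, and `t δ ≤ δ +
δ² ε^{-1/2}` is within the last two terms of the rate because `α > 1` (`one_add_mul_le_rate`).
-/

noncomputable section

namespace GSIR

/-! ### Operators that are diagonal in a Hilbert basis -/

section Diagonal

variable {ι H : Type*} [NormedAddCommGroup H] [InnerProductSpace ℝ H]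
  {b : HilbertBasis ι ℝ H} {f g : ι → ℝ} {T U : H →L[ℝ] H}

/-- `T` is diagonal in the Hilbert basis `b`, with eigenvalue `f i` at `b i`. -/
def IsDiag (b : HilbertBasis ι ℝ H) (f : ι → ℝ) (T : H →L[ℝ] H) : Prop :=
  ∀ i, T (b i) = f i • b i

lemma hasSum_inner_smul (b : HilbertBasis ι ℝ H) (x : H) :
    HasSum (fun i => inner ℝ (b i) x • b i) x := by
  simpa only [b.repr_apply_apply] using b.hasSum_repr x

lemma hasSum_inner_sq (b : HilbertBasis ι ℝ H) (x : H) :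
    HasSum (fun i => inner ℝ (b i) x ^ 2) (‖x‖ ^ 2) := by
  have h := b.hasSum_inner_mul_inner x x
  rw [real_inner_self_eq_norm_sq] at h
  refine h.congr_fun ?_
  intro i
  rw [real_inner_comm x (b i), sq]

lemma sum_inner_sq_le (b : HilbertBasis ι ℝ H) (x : H) (s : Finset ι) :
    ∑ i ∈ s, inner ℝ (b i) x ^ 2 ≤ ‖x‖ ^ 2 :=
  sum_le_hasSum s (fun _ _ => sq_nonneg _) (hasSum_inner_sq b x)

lemma clm_ext_hilbertBasis {F : Type*} [NormedAddCommGroup F] [NormedSpace ℝ F]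
    (b : HilbertBasis ι ℝ H) {T U : H →L[ℝ] F} (h : ∀ i, T (b i) = U (b i)) : T = U := by
  ext x
  have hT := (hasSum_inner_smul b x).mapL T
  have hU := (hasSum_inner_smul b x).mapL U
  simp only [map_smul, h] at hT hU
  exact hT.unique hU

lemma IsDiag.inner_apply (hT : IsDiag b f T) (i : ι) (x : H) :
    inner ℝ (b i) (T x) = f i * inner ℝ (b i) x := by
  have h := ((hasSum_inner_smul b x).mapL T).mapL (innerSL ℝ (b i))
  simp only [map_smul, hT _, innerSL_apply_apply, smul_eq_mul] at h
  refine h.unique ?_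
  convert hasSum_single i fun j hj => ?_ using 1
  · rw [real_inner_self_eq_norm_sq, b.orthonormal.1 i]; ring
  · rw [b.orthonormal.2 hj.symm]; ring

lemma IsDiag.unique (hT : IsDiag b f T) (hU : IsDiag b g U) (h : ∀ i, f i = g i) : T = U :=
  clm_ext_hilbertBasis b fun i => by rw [hT i, hU i, h i]

lemma isDiag_id : IsDiag b (fun _ => 1) (ContinuousLinearMap.id ℝ H) := fun i => by simp

lemma IsDiag.comp (hT : IsDiag b f T) (hU : IsDiag b g U) :
    IsDiag b (fun i => f i * g i) (T ∘L U) := fun i => by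
  simp [hT i, hU i, smul_smul, mul_comm]

lemma IsDiag.add (hT : IsDiag b f T) (hU : IsDiag b g U) :
    IsDiag b (fun i => f i + g i) (T + U) := fun i => by
  simp [hT i, hU i, add_smul]

lemma IsDiag.sub (hT : IsDiag b f T) (hU : IsDiag b g U) :
    IsDiag b (fun i => f i - g i) (T - U) := fun i => by
  simp [hT i, hU i, sub_smul]

lemma IsDiag.add_smul_id (hT : IsDiag b f T) (c : ℝ) :
    IsDiag b (fun i => f i + c) (T + c • ContinuousLinearMap.id ℝ H) := fun i => by
  simp [hT i, add_smul]

lemma IsDiag.norm_le (hT : IsDiag b f T) {c : ℝ} (hc : 0 ≤ c) (hf : ∀ i, |f i| ≤ c) :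
    ‖T‖ ≤ c := by
  refine T.opNorm_le_bound hc fun x => ?_
  refine le_of_sq_le_sq ?_ (by positivity)
  rw [mul_pow]
  refine hasSum_le (fun i => ?_) (hasSum_inner_sq b (T x)) ((hasSum_inner_sq b x).mul_left _)
  rw [hT.inner_apply, mul_pow]
  gcongr ?_ * _
  exact sq_le_sq' (neg_le_of_abs_le (hf i)) (le_of_abs_le (hf i))

lemma IsDiag.inner_comm (hT : IsDiag b f T) (x y : H) :
    inner ℝ (T x) y = inner ℝ x (T y) := by
  refine (b.hasSum_inner_mul_inner (T x) y).unique
    ((b.hasSum_inner_mul_inner x (T y)).congr_fun fun i => ?_)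
  rw [hT.inner_apply, real_inner_comm, hT.inner_apply, real_inner_comm]
  ring

lemma IsDiag.adjoint_eq [CompleteSpace H] (hT : IsDiag b f T) :
    ContinuousLinearMap.adjoint T = T :=
  ((ContinuousLinearMap.eq_adjoint_iff T T).2 hT.inner_comm).symm

lemma IsDiag.inner_nonneg (hT : IsDiag b f T) (hf : ∀ i, 0 ≤ f i) (x : H) :
    0 ≤ inner ℝ x (T x) := by
  refine (b.hasSum_inner_mul_inner x (T x)).nonneg fun i => ?_
  rw [hT.inner_apply, real_inner_comm x (b i)]
  have := hf i
  nlinarith [mul_self_nonneg (inner ℝ x (b i))]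

lemma exists_isDiag (b : HilbertBasis ι ℝ H) {f : ι → ℝ} {c : ℝ} (hf : ∀ i, |f i| ≤ c) :
    ∃ T, IsDiag b f T := by
  have key : ∀ x i, (f i * inner ℝ (b i) x) ^ 2 ≤ c ^ 2 * inner ℝ (b i) x ^ 2 := fun x i => by
    rw [mul_pow]
    gcongr ?_ * _
    exact sq_le_sq' (neg_le_of_abs_le (hf i)) (le_of_abs_le (hf i))
  have hs : ∀ x, Summable fun i => (f i * inner ℝ (b i) x) ^ 2 := fun x =>
    Summable.of_nonneg_of_le (fun i => sq_nonneg _) (key x)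
      ((hasSum_inner_sq b x).summable.mul_left _)
  have hmem : ∀ x, Memℓp (fun i => f i * inner ℝ (b i) x) 2 := fun x => by
    refine memℓp_gen ?_
    simpa [← mul_pow, ← abs_mul] using hs x
  let L : H →ₗ[ℝ] H :=
    { toFun := fun x => b.repr.symm ⟨fun i => f i * inner ℝ (b i) x, hmem x⟩
      map_add' := fun x y => by
        rw [← map_add]
        congr 1
        ext i
        simp [inner_add_right, mul_add]
        rfl
      map_smul' := fun r x => by
        rw [RingHom.id_apply, ← map_smul]
        congr 1
        ext i
        simp [inner_smul_right, mul_left_comm] }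
  have hL : ∀ x i, inner ℝ (b i) (L x) = f i * inner ℝ (b i) x := fun x i => by
    rw [← b.repr_apply_apply]
    simp [L]
  refine ⟨L.mkContinuous |c| fun x => ?_, fun i => ?_⟩
  · refine le_of_sq_le_sq ?_ (by positivity)
    rw [mul_pow, sq_abs]
    refine hasSum_le (fun i => ?_) (hasSum_inner_sq b (L x)) ((hasSum_inner_sq b x).mul_left _)
    rw [hL]
    exact key x i
  · refine b.repr.injective (lp.ext (funext fun j => ?_))
    rw [b.repr_apply_apply, b.repr_apply_apply, LinearMap.mkContinuous_apply, hL, inner_smul_right]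
    by_cases h : j = i
    · rw [h]
    · rw [b.orthonormal.2 h]; ring

/-- The bounded operator with eigenvalues `a i ^ s` is the power `A ^ s` in the sense of the
eigenspace condition: an eigenvector of `A` for `μ` has coordinates only where `a i = μ`. -/
lemma IsDiag.isOpPow {A : H →L[ℝ] H} {a : ι → ℝ} {s : ℝ} (hA : IsDiag b a A)
    (hT : IsDiag b (fun i => a i ^ s) T) : IsOpPow A s T := by
  intro μ v hv
  refine b.repr.injective (lp.ext (funext fun j => ?_))
  rw [b.repr_apply_apply, b.repr_apply_apply, hT.inner_apply, inner_smul_right]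
  have h : a j * inner ℝ (b j) v = μ * inner ℝ (b j) v := by
    rw [← hA.inner_apply, hv, inner_smul_right]
  rcases eq_or_ne (inner ℝ (b j) v) 0 with h0 | h0
  · rw [h0]; ring
  · rw [mul_right_cancel₀ h0 h]

lemma IsDiag.opPow {A : H →L[ℝ] H} {a : ι → ℝ} (hA : IsDiag b a A) {s c : ℝ}
    (hc : ∀ i, |a i ^ s| ≤ c) : IsDiag b (fun i => a i ^ s) (opPow A s) := by
  obtain ⟨T, hT⟩ := exists_isDiag b hc
  have h : ∃ T, IsOpPow A s T := ⟨T, hA.isOpPow hT⟩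
  intro i
  rw [GSIR.opPow, dif_pos h]
  exact h.choose_spec (a i) (b i) (hA i)

/-- An operator that acts diagonally on an orthonormal set and vanishes on its orthogonal
complement is diagonal in a Hilbert basis extending the set. -/
lemma exists_isDiag_extension [CompleteSpace H] {s : Set H}
    (hs : Orthonormal ℝ ((↑) : s → H)) {A : H →L[ℝ] H}
    (hA : ∀ x ∈ s, ∃ c : ℝ, A x = c • x) (hA0 : ∀ x, (∀ y ∈ s, inner ℝ y x = 0) → A x = 0) :
    ∃ (w : Set H) (b : HilbertBasis w ℝ H), s ⊆ w ∧ (⇑b = ((↑) : w → H)) ∧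
      (∀ i : w, (i : H) ∉ s → A i = 0) ∧ IsDiag b (fun i => inner ℝ (b i) (A (b i))) A := by
  obtain ⟨w, b, hsw, hb⟩ := hs.exists_hilbertBasis_extension
  have h0 : ∀ i : w, (i : H) ∉ s → A i = 0 := fun i hi => hA0 _ fun y hy => by
    have h := b.orthonormal.2 (i := ⟨y, hsw hy⟩) (j := i) (by rintro rfl; exact hi hy)
    rwa [hb] at h
  refine ⟨w, b, hsw, hb, h0, fun i => ?_⟩
  by_cases hi : (i : H) ∈ s
  · obtain ⟨c, hc⟩ := hA _ hi
    have hbi : A (b i) = c • b i := by rw [hb, hc]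
    simp only [hbi, inner_smul_right, real_inner_self_eq_norm_sq, b.orthonormal.1 i, one_pow,
      mul_one]
  · simp [hb, h0 i hi]

end Diagonal

/-! ### Perturbation of inverse square roots -/

section Perturbation

variable {ι κ H K : Type*} [NormedAddCommGroup H] [InnerProductSpace ℝ H]
  [NormedAddCommGroup K] [InnerProductSpace ℝ K]
  {b : HilbertBasis ι ℝ H} {e : HilbertBasis κ ℝ H} {α : κ → ℝ} {γ : ι → ℝ}
  {A B Ai Bi Bh : H →L[ℝ] H} {ε δ : ℝ}

lemma IsDiag.abs_le_norm {f : ι → ℝ} {T : H →L[ℝ] H} (hT : IsDiag b f T) (i : ι) :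
    |f i| ≤ ‖T‖ := by
  have h := T.le_opNorm (b i)
  rwa [hT i, norm_smul, b.orthonormal.1 i, mul_one, mul_one, Real.norm_eq_abs] at h

lemma norm_invSqrt_le (hAi : IsDiag e (fun k => (√(α k))⁻¹) Ai) (hε : 0 < ε)
    (hα : ∀ k, ε ≤ α k) : ‖Ai‖ ≤ (√ε)⁻¹ := by
  refine hAi.norm_le (by positivity) fun k => ?_
  rw [abs_of_nonneg (by positivity)]
  exact inv_anti₀ (Real.sqrt_pos.2 hε) (Real.sqrt_le_sqrt (hα k))

/-- A one-sided comparison of `A` with `B` that needs no smallness of `A - B`: the norm `t` of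
`A^{-1/2} B^{1/2}` satisfies `t² = ‖A^{-1/2} B A^{-1/2}‖ ≤ 1 + t δ ε^{-1/2}`. -/
lemma norm_invSqrt_comp_sqrt_le [CompleteSpace H] (hA : IsDiag e α A)
    (hAi : IsDiag e (fun k => (√(α k))⁻¹) Ai) (hB : IsDiag b γ B)
    (hBi : IsDiag b (fun i => (√(γ i))⁻¹) Bi) (hBh : IsDiag b (fun i => √(γ i)) Bh)
    (hε : 0 < ε) (hα : ∀ k, ε ≤ α k) (hγ : ∀ i, ε ≤ γ i) (hδ : ‖Bi ∘L (A - B)‖ ≤ δ) :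
    ‖Ai ∘L Bh‖ ≤ 1 + δ * (√ε)⁻¹ := by
  have hα0 : ∀ k, 0 < α k := fun k => hε.trans_le (hα k)
  have hγ0 : ∀ i, 0 < γ i := fun i => hε.trans_le (hγ i)
  have hBB : Bh ∘L Bh = B := (hBh.comp hBh).unique hB fun i =>
    Real.mul_self_sqrt (hγ0 i).le
  have hBhi : Bh ∘L Bi = ContinuousLinearMap.id ℝ H := (hBh.comp hBi).unique isDiag_id
    fun i => mul_inv_cancel₀ (Real.sqrt_pos.2 (hγ0 i)).ne'
  have hAA : Ai ∘L A ∘L Ai = ContinuousLinearMap.id ℝ H :=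
    (hAi.comp (hA.comp hAi)).unique isDiag_id fun i => by
      have h0 := (Real.sqrt_pos.2 (hα0 i)).ne'
      field_simp
      rw [Real.sq_sqrt (hα0 i).le]
  set Tm := Ai ∘L Bh with hTm
  have hadj : ContinuousLinearMap.adjoint Tm = Bh ∘L Ai := by
    rw [hTm, ContinuousLinearMap.adjoint_comp, hAi.adjoint_eq, hBh.adjoint_eq]
  have hsq : ‖Tm‖ * ‖Tm‖ = ‖Tm ∘L ContinuousLinearMap.adjoint Tm‖ := by
    have h := ContinuousLinearMap.norm_adjoint_comp_self (ContinuousLinearMap.adjoint Tm)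
    rw [ContinuousLinearMap.adjoint_adjoint, LinearIsometryEquiv.norm_map] at h
    exact h.symm
  have hprod : Tm ∘L ContinuousLinearMap.adjoint Tm
      = ContinuousLinearMap.id ℝ H - Tm ∘L (Bi ∘L (A - B)) ∘L Ai := by
    rw [hadj, hTm, ← hAA]
    ext x
    have h1 := fun y => congrArg (fun T : H →L[ℝ] H => T y) hBB
    have h2 := fun y => congrArg (fun T : H →L[ℝ] H => T y) hBhi
    simp only [ContinuousLinearMap.comp_apply, ContinuousLinearMap.id_apply] at h1 h2
    simp [h1, h2]
  have hid : ‖ContinuousLinearMap.id ℝ H‖ ≤ 1 := ContinuousLinearMap.norm_id_le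
  have hAin := norm_invSqrt_le hAi hε hα
  have hδ0 : 0 ≤ δ := (norm_nonneg _).trans hδ
  have hbound : ‖Tm‖ * ‖Tm‖ ≤ 1 + ‖Tm‖ * (δ * (√ε)⁻¹) := by
    rw [hsq, hprod]
    refine (norm_sub_le _ _).trans (add_le_add hid ?_)
    refine (ContinuousLinearMap.opNorm_comp_le _ _).trans ?_
    gcongr
    refine (ContinuousLinearMap.opNorm_comp_le _ _).trans ?_
    gcongr
  have hu : 0 ≤ δ * (√ε)⁻¹ := by positivity
  by_contra! hlt
  nlinarith [norm_nonneg Tm]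

/-- The vector `w = (A^{-1/2} - γᵢ^{-1/2}) bᵢ` solves
`(A^{1/2} + γᵢ^{1/2}) w = -γᵢ^{-1/2} A^{-1/2} (A - B) bᵢ`, and `A^{1/2} ≥ 0`. -/
lemma norm_invSqrt_sub_apply_le (hA : IsDiag e α A)
    (hAi : IsDiag e (fun k => (√(α k))⁻¹) Ai) (hB : IsDiag b γ B)
    (hα : ∀ k, 0 < α k) (i : ι) (hγ : 0 < γ i) :
    ‖Ai (b i) - (√(γ i))⁻¹ • b i‖ ≤ (γ i)⁻¹ * ‖Ai ((A - B) (b i))‖ := by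
  obtain ⟨Ah, hAh⟩ : ∃ Ah, IsDiag e (fun k => √(α k)) Ah :=
    exists_isDiag e (c := √‖A‖) fun k => by
      rw [abs_of_nonneg (Real.sqrt_nonneg _)]
      exact Real.sqrt_le_sqrt ((le_abs_self _).trans (hA.abs_le_norm k))
  have h1 : Ah ∘L Ai = ContinuousLinearMap.id ℝ H := (hAh.comp hAi).unique isDiag_id
    fun k => mul_inv_cancel₀ (Real.sqrt_pos.2 (hα k)).ne'
  have h2 : Ai ∘L A = Ah := (hAi.comp hA).unique hAh fun k => by
    have h0 := (Real.sqrt_pos.2 (hα k)).ne'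
    field_simp
    rw [Real.sq_sqrt (hα k).le]
  set r := √(γ i) with hr
  have hr0 : 0 < r := Real.sqrt_pos.2 hγ
  have hrr : γ i = r * r := (Real.mul_self_sqrt hγ.le).symm
  set w := Ai (b i) - r⁻¹ • b i with hw
  have hAw : Ah w = b i - r⁻¹ • Ah (b i) := by
    have := congrArg (fun T : H →L[ℝ] H => T (b i)) h1
    simp only [ContinuousLinearMap.comp_apply, ContinuousLinearMap.id_apply] at this
    rw [hw, map_sub, map_smul, this]
  have hsum : Ah w + r • w = -(r⁻¹ • Ai ((A - B) (b i))) := by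
    have h2' := congrArg (fun T : H →L[ℝ] H => T (b i)) h2
    simp only [ContinuousLinearMap.comp_apply] at h2'
    rw [hAw, hw, sub_apply, hB i, map_sub, h2', map_smul, hrr, smul_sub,
      smul_sub, smul_smul, smul_smul, mul_inv_cancel₀ hr0.ne', inv_mul_cancel_left₀ hr0.ne',
      one_smul]
    abel
  have hpos : r * ‖w‖ ≤ ‖Ah w + r • w‖ := by
    rcases (norm_nonneg w).eq_or_lt with h0 | h0
    · rw [← h0, mul_zero]; exact norm_nonneg _
    · refine le_of_mul_le_mul_right ?_ h0
      calc r * ‖w‖ * ‖w‖ ≤ inner ℝ w (Ah w) + r * (‖w‖ * ‖w‖) := by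
            have := hAh.inner_nonneg (fun k => Real.sqrt_nonneg _) w
            linarith
        _ = inner ℝ w (Ah w + r • w) := by
            rw [inner_add_right, inner_smul_right, real_inner_self_eq_norm_mul_norm]
        _ ≤ ‖w‖ * ‖Ah w + r • w‖ := real_inner_le_norm _ _
        _ = _ := mul_comm _ _
  rw [hsum, norm_neg, norm_smul, Real.norm_eq_abs, abs_of_pos (inv_pos.2 hr0)] at hpos
  rw [hrr, mul_inv, mul_assoc]
  calc ‖w‖ = r⁻¹ * (r * ‖w‖) := by field_simp
    _ ≤ _ := by gcongr

/-- The square root of `∑ᵢ ‖zᵢ‖² / γᵢ`, where `zᵢ = D* bᵢ`, is the Hilbert-Schmidt norm of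
`B^{-1/2} D`, so it bounds the operator norm. -/
lemma norm_invSqrt_comp_le {D : K →L[ℝ] H} {z : ι → K}
    (hBi : IsDiag b (fun i => (√(γ i))⁻¹) Bi) (hγ : ∀ i, 0 < γ i)
    (hz : ∀ i g, inner ℝ (b i) (D g) = inner ℝ (z i) g) (hδ0 : 0 ≤ δ)
    (hδ : ∀ s : Finset ι, ∑ i ∈ s, ‖z i‖ ^ 2 / γ i ≤ δ ^ 2) : ‖Bi ∘L D‖ ≤ δ := by
  refine ContinuousLinearMap.opNorm_le_bound _ hδ0 fun x => le_of_sq_le_sq ?_ (by positivity)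
  refine hasSum_le_of_sum_le (hasSum_inner_sq b ((Bi ∘L D) x)) fun s => ?_
  calc ∑ i ∈ s, inner ℝ (b i) ((Bi ∘L D) x) ^ 2
      ≤ ∑ i ∈ s, ‖z i‖ ^ 2 / γ i * ‖x‖ ^ 2 := by
        refine Finset.sum_le_sum fun i _ => ?_
        rw [ContinuousLinearMap.comp_apply, hBi.inner_apply, hz, mul_pow, inv_pow,
          Real.sq_sqrt (hγ i).le, inv_mul_eq_div, div_mul_eq_mul_div, ← mul_pow]
        have := hγ i
        gcongr ?_ / _
        exact sq_le_sq' (neg_le_of_abs_le (abs_real_inner_le_norm _ _)) (real_inner_le_norm _ _)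
    _ ≤ _ := by
        rw [← Finset.sum_mul, mul_pow]
        gcongr
        exact hδ s

/-- The Hilbert-Schmidt norm of `B^{-1/2} D`, computed by columns instead of rows. -/
lemma sum_norm_sq_invSqrt_comp_le {D : H →L[ℝ] H} {z : ι → H}
    (hBi : IsDiag b (fun i => (√(γ i))⁻¹) Bi) (hγ : ∀ i, 0 < γ i)
    (hz : ∀ i g, inner ℝ (b i) (D g) = inner ℝ (z i) g)
    (hδ : ∀ s : Finset ι, ∑ i ∈ s, ‖z i‖ ^ 2 / γ i ≤ δ ^ 2) (t : Finset ι) :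
    ∑ j ∈ t, ‖Bi (D (b j))‖ ^ 2 ≤ δ ^ 2 := by
  refine hasSum_le_of_sum_le (hasSum_sum fun j _ => hasSum_inner_sq b (Bi (D (b j)))) fun s => ?_
  refine le_trans (Finset.sum_le_sum fun i _ => ?_) (hδ s)
  have h : ∀ j, inner ℝ (b i) (Bi (D (b j))) ^ 2 = inner ℝ (b j) (z i) ^ 2 / γ i := fun j => by
    rw [hBi.inner_apply, hz, mul_pow, inv_pow, Real.sq_sqrt (hγ i).le, inv_mul_eq_div,
      real_inner_comm]
  simp only [h]
  rw [← Finset.sum_div]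
  have := hγ i
  gcongr
  exact sum_inner_sq_le b (z i) t

/-- The error `(A^{-1/2} - B^{-1/2}) G` for a diagonal `G` dominated by a multiple of `B`. The bound
on each basis vector is summed by the Cauchy-Schwarz inequality, which is where the
Hilbert-Schmidt norm of `B^{-1/2} (A - B)` is needed rather than its operator norm. -/
lemma norm_invSqrt_sub_comp_le {t c : ℝ} {g : ι → ℝ} {G : H →L[ℝ] H} {z : ι → H}
    (hA : IsDiag e α A) (hAi : IsDiag e (fun k => (√(α k))⁻¹) Ai) (hB : IsDiag b γ B)
    (hBi : IsDiag b (fun i => (√(γ i))⁻¹) Bi) (hG : IsDiag b g G)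
    (hα : ∀ k, 0 < α k) (hγ : ∀ i, 0 < γ i)
    (hz : ∀ i x, inner ℝ (b i) ((A - B) x) = inner ℝ (z i) x) (hδ0 : 0 ≤ δ)
    (hδ : ∀ s : Finset ι, ∑ i ∈ s, ‖z i‖ ^ 2 / γ i ≤ δ ^ 2)
    (ht : ∀ v, ‖Ai v‖ ≤ t * ‖Bi v‖) (ht0 : 0 ≤ t) (hc : 0 ≤ c) (hg : ∀ i, |g i| ≤ c * γ i) :
    ‖(Ai - Bi) ∘L G‖ ≤ c * t * δ := by
  refine ContinuousLinearMap.opNorm_le_bound _ (by positivity) fun y => ?_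
  have hsum := (hasSum_inner_smul b y).mapL ((Ai - Bi) ∘L G)
  refine le_of_tendsto hsum.norm (Eventually.of_forall fun s => ?_)
  calc ‖∑ i ∈ s, ((Ai - Bi) ∘L G) (inner ℝ (b i) y • b i)‖
      ≤ ∑ i ∈ s, c * t * (|inner ℝ (b i) y| * ‖Bi ((A - B) (b i))‖) := by
        refine norm_sum_le_of_le s fun i _ => ?_
        rw [map_smul, ContinuousLinearMap.comp_apply, hG i, map_smul,
          sub_apply, hBi i, norm_smul, norm_smul, Real.norm_eq_abs,
          Real.norm_eq_abs]
        have h1 := norm_invSqrt_sub_apply_le hA hAi hB hα i (hγ i)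
        have h2 := ht ((A - B) (b i))
        calc |inner ℝ (b i) y| * (|g i| * ‖Ai (b i) - (√(γ i))⁻¹ • b i‖)
            ≤ |inner ℝ (b i) y| *
              (c * γ i * ((γ i)⁻¹ * (t * ‖Bi ((A - B) (b i))‖))) := by
              have := hγ i
              gcongr
              · exact hg i
              · exact h1.trans (by gcongr)
          _ = _ := by
              have := (hγ i).ne'
              field_simp
    _ = c * t * ∑ i ∈ s, |inner ℝ (b i) y| * ‖Bi ((A - B) (b i))‖ := by rw [Finset.mul_sum]
    _ ≤ c * t * (‖y‖ * δ) := by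
        gcongr
        refine le_of_sq_le_sq ?_ (by positivity)
        refine (Finset.sum_mul_sq_le_sq_mul_sq s _ _).trans ?_
        rw [mul_pow]
        gcongr
        · simpa only [sq_abs] using sum_inner_sq_le b y s
        · exact sum_norm_sq_invSqrt_comp_le hBi hγ hz hδ s
    _ = _ := by ring

/-- Interpolation: `l^m ε^{1-m} ≤ l + ε` for `m ∈ [0, 1]`, which turns smoothness `θ` into the
bias rate `ε ^ min θ 1`. -/
lemma rpow_mul_div_add_le {l ε θ L : ℝ} (hl : 0 ≤ l) (hL : l ≤ L) (hε : 0 < ε) (hθ : 0 < θ) :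
    l ^ θ * (ε / (l + ε)) ≤ L ^ (θ - min θ 1) * ε ^ min θ 1 := by
  rcases hl.eq_or_lt with rfl | hl0
  · rw [Real.zero_rpow hθ.ne', zero_mul]
    positivity
  set m := min θ 1 with hm
  have hm0 : 0 < m := lt_min hθ one_pos
  have hm1 : m ≤ 1 := min_le_right _ _
  have h1 : l ^ m * ε ^ (1 - m) ≤ l + ε := by
    calc l ^ m * ε ^ (1 - m) ≤ (l + ε) ^ m * (l + ε) ^ (1 - m) := by
          have : 0 ≤ 1 - m := by linarith
          gcongr <;> linarith
      _ = l + ε := by rw [← Real.rpow_add (by positivity), add_sub_cancel, Real.rpow_one]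
  have h2 : l ^ θ = l ^ (θ - m) * l ^ m := by rw [← Real.rpow_add hl0, sub_add_cancel]
  have h3 : ε = ε ^ (1 - m) * ε ^ m := by rw [← Real.rpow_add hε, sub_add_cancel, Real.rpow_one]
  have h4 : l ^ (θ - m) ≤ L ^ (θ - m) :=
    Real.rpow_le_rpow hl hL (sub_nonneg.2 (min_le_left _ _))
  calc l ^ θ * (ε / (l + ε)) = l ^ (θ - m) * (l ^ m * ε ^ (1 - m)) / (l + ε) * ε ^ m := by
        rw [h2]; nth_rewrite 1 [h3]; ring
    _ ≤ l ^ (θ - m) * (l + ε) / (l + ε) * ε ^ m := by gcongr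
    _ = l ^ (θ - m) * ε ^ m := by field_simp
    _ ≤ _ := by gcongr

/-- Bias of the regularization at one eigenvalue, by `1 - √u ≤ 1 - u` with `u = l / (l + ε)`. -/
lemma abs_regularization_bias_le {l ε β L : ℝ} (hl : 0 ≤ l) (hL : l ≤ L) (hε : 0 < ε)
    (hβ : 0 < β) :
    |(√(l + ε))⁻¹ * l ^ (1 + β) - l ^ (β + 1 / 2)|
      ≤ L ^ (β + 1 / 2 - min (β + 1 / 2) 1) * ε ^ min (β + 1 / 2) 1 := by
  refine le_trans ?_ (rpow_mul_div_add_le hl hL hε (by positivity : (0 : ℝ) < β + 1 / 2))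
  have h1 : l ^ (1 + β) = l ^ (β + 1 / 2) * √l := by
    rw [Real.sqrt_eq_rpow, ← Real.rpow_add_of_nonneg hl (by positivity) (by positivity)]
    congr 1; ring
  have hs : 0 < √(l + ε) := Real.sqrt_pos.2 (by positivity)
  have hle : √l ≤ √(l + ε) := Real.sqrt_le_sqrt (by linarith)
  have h2 : (√(l + ε))⁻¹ * l ^ (1 + β) - l ^ (β + 1 / 2)
      = -(l ^ (β + 1 / 2) * (1 - √l / √(l + ε))) := by
    rw [h1]; field_simp; ring
  have hu1 : √l / √(l + ε) ≤ 1 := (div_le_one hs).2 hle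
  have hu0 : 0 ≤ √l / √(l + ε) := by positivity
  rw [h2, abs_neg, abs_of_nonneg (mul_nonneg (by positivity) (by linarith))]
  gcongr
  have h3 : ε / (l + ε) = 1 - (√l / √(l + ε)) ^ 2 := by
    rw [div_pow, Real.sq_sqrt hl, Real.sq_sqrt (by positivity)]
    field_simp; ring
  rw [h3]
  nlinarith

end Perturbation

/-! ### Eigenbases and effective dimension -/

section Eigenbases

variable {H : Type*} [NormedAddCommGroup H] [InnerProductSpace ℝ H]

/-- Comparison of `∑ k ^ (-α)` with a telescoping sum. -/
lemma rpow_neg_le_sub {α : ℝ} (hα : 1 < α) {k : ℝ} (hk : 0 < k) :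
    (k + 1) ^ (-α) ≤ (k ^ (1 - α) - (k + 1) ^ (1 - α)) / (α - 1) := by
  have hx : 0 < k / (k + 1) := by positivity
  have h1 : 1 + (α - 1) / (k + 1) ≤ (k / (k + 1)) ^ (1 - α) := by
    rw [Real.rpow_def_of_pos hx]
    have h2 := Real.log_le_sub_one_of_pos hx
    have h3 : k / (k + 1) - 1 = -(1 / (k + 1)) := by field_simp; ring
    have h4 := Real.add_one_le_exp (Real.log (k / (k + 1)) * (1 - α))
    have h5 : (α - 1) / (k + 1) = (α - 1) * (1 / (k + 1)) := by ring
    rw [h5]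
    nlinarith
  have h2 : (k + 1) ^ (-α) = (k + 1) ^ (1 - α) / (k + 1) := by
    rw [div_eq_mul_inv, ← Real.rpow_neg_one, ← Real.rpow_add (by positivity)]
    congr 1; ring
  rw [Real.div_rpow hk.le (by positivity), le_div_iff₀ (by positivity)] at h1
  rw [le_div_iff₀ (by linarith), h2]
  calc (k + 1) ^ (1 - α) / (k + 1) * (α - 1)
      = (1 + (α - 1) / (k + 1)) * (k + 1) ^ (1 - α) - (k + 1) ^ (1 - α) := by ring
    _ ≤ _ := by linarith

/-- The effective dimension of a spectrum decaying like `k ^ (-α)`: the first `ε ^ (-1/α)` terms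
are bounded by `1`, and the others by `lam k / ε`. -/
lemma exists_sum_div_add_le {α : ℝ} (hα : 1 < α) {lam : ℕ → ℝ} {C : ℝ} (hC : 0 ≤ C)
    (h0 : ∀ k, 0 ≤ lam k) (hlam : ∀ k, lam k ≤ C * ((k : ℝ) + 1) ^ (-α)) :
    ∃ C' : ℝ, 0 < C' ∧ ∀ ε : ℝ, 0 < ε → ε ≤ 1 → ∀ s : Finset ℕ,
      ∑ k ∈ s, lam k / (lam k + ε) ≤ C' * ε ^ (-(1 / α)) := by
  have hα1 : 0 < α - 1 := by linarith
  have hαp : 0 < α := by linarith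
  refine ⟨2 + C / (α - 1), by positivity, fun ε hε hε1 s => ?_⟩
  have hE1 : 1 ≤ ε ^ (-(1 / α)) := Real.one_le_rpow_of_pos_of_le_one_of_nonpos hε hε1
    (by rw [neg_nonpos]; positivity)
  set E := ε ^ (-(1 / α)) with hE
  set N := ⌈E⌉₊ with hN
  have hEN : E ≤ N := Nat.le_ceil E
  have hNE : (N : ℝ) ≤ 2 * E := by
    have := Nat.ceil_lt_add_one (show 0 ≤ E by linarith)
    rw [← hN] at this
    linarith
  have hterm : ∀ k, 0 ≤ lam k / (lam k + ε) := fun k => by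
    have := h0 k
    positivity
  obtain ⟨m, hm⟩ : ∃ m, s ⊆ Finset.range (N + m) := by
    refine ⟨s.sup id + 1, fun k hk => Finset.mem_range.2 ?_⟩
    have : k ≤ s.sup id := Finset.le_sup (f := id) hk
    omega
  refine (Finset.sum_le_sum_of_subset_of_nonneg hm fun k _ _ => hterm k).trans ?_
  rw [Finset.sum_range_add]
  have hA : ∑ k ∈ Finset.range N, lam k / (lam k + ε) ≤ 2 * E := by
    refine le_trans (Finset.sum_le_card_nsmul _ _ 1 fun k _ => ?_) (by simpa using hNE)
    have := h0 k
    rw [div_le_one (by positivity)]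
    linarith
  have hB : ∑ j ∈ Finset.range m, lam (N + j) / (lam (N + j) + ε) ≤ C / (α - 1) * E := by
    have hN0 : 0 < (N : ℝ) := by linarith
    have hstep : ∀ j ∈ Finset.range m, lam (N + j) / (lam (N + j) + ε)
        ≤ C / (ε * (α - 1)) *
          (((N + j : ℕ) : ℝ) ^ (1 - α) - ((N + (j + 1) : ℕ) : ℝ) ^ (1 - α)) := fun j _ => by
      have hk : 0 < ((N + j : ℕ) : ℝ) := by push_cast; positivity
      have h1 := rpow_neg_le_sub hα hk
      have h2 := h0 (N + j)
      have h3 : ((N + (j + 1) : ℕ) : ℝ) = ((N + j : ℕ) : ℝ) + 1 := by push_cast; ring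
      rw [h3]
      calc lam (N + j) / (lam (N + j) + ε) ≤ lam (N + j) / ε := by
            gcongr; linarith
        _ ≤ C * (((N + j : ℕ) : ℝ) + 1) ^ (-α) / ε := by gcongr; exact hlam _
        _ ≤ C * ((((N + j : ℕ) : ℝ) ^ (1 - α) - (((N + j : ℕ) : ℝ) + 1) ^ (1 - α)) / (α - 1))
            / ε := by gcongr
        _ = _ := by field_simp
    refine (Finset.sum_le_sum hstep).trans ?_
    rw [← Finset.mul_sum,
      Finset.sum_range_sub' (fun j => ((N + j : ℕ) : ℝ) ^ (1 - α)) m, add_zero]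
    have h1 : (0 : ℝ) ≤ ((N + m : ℕ) : ℝ) ^ (1 - α) := by positivity
    have h2 : (N : ℝ) ^ (1 - α) ≤ ε * E := by
      calc (N : ℝ) ^ (1 - α) ≤ E ^ (1 - α) :=
            Real.rpow_le_rpow_of_nonpos (by linarith) hEN (by linarith)
        _ = ε * E := by
            rw [hE, ← Real.rpow_mul hε.le]
            nth_rewrite 2 [← Real.rpow_one ε]
            rw [← Real.rpow_add hε]
            congr 1
            field_simp
            ring
    calc C / (ε * (α - 1)) * ((N : ℝ) ^ (1 - α) - ((N + m : ℕ) : ℝ) ^ (1 - α))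
        ≤ C / (ε * (α - 1)) * (ε * E) := by gcongr; linarith
      _ = _ := by field_simp
  calc _ ≤ 2 * E + C / (α - 1) * E := add_le_add hA hB
    _ = _ := by ring

lemma IsEigenSeq.apply_eq {A : H →L[ℝ] H} {lam : ℕ → ℝ} {φ : ℕ → H} (h : IsEigenSeq A lam φ)
    (k : ℕ) : A (φ k) = lam k • φ k := by
  refine (h.2.2 (φ k)).unique ?_
  convert hasSum_single k fun j hj => ?_ using 1
  · rw [real_inner_self_eq_norm_sq, h.2.1.1 k]; norm_num
  · rw [h.2.1.2 hj, mul_zero, zero_smul]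

/-- A Hilbert basis of eigenvectors of an operator with polynomially decaying eigenvalues, and the
bound for its effective dimension. -/
lemma EigenDecay.exists_isDiag [CompleteSpace H] {A : H →L[ℝ] H} {α : ℝ} (hα : 1 < α)
    (h : EigenDecay A α) :
    ∃ (w : Set H) (b : HilbertBasis w ℝ H) (a : w → ℝ), IsDiag b a A ∧ (∀ i, 0 ≤ a i) ∧
      ∃ C : ℝ, 0 < C ∧ ∀ ε : ℝ, 0 < ε → ε ≤ 1 → ∀ s : Finset w,
        ∑ i ∈ s, a i / (a i + ε) ≤ C * ε ^ (-(1 / α)) := by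
  obtain ⟨lam, φ, hE, c, C, hc, hC, hlam⟩ := h
  have hlam0 : ∀ k, 0 ≤ lam k := fun k => le_trans (by positivity) (hlam k).1
  obtain ⟨w, b, hw, hb, hb0, hdiag⟩ := exists_isDiag_extension (s := Set.range φ) (A := A)
    hE.2.1.toSubtypeRange (by
      rintro _ ⟨k, rfl⟩
      exact ⟨lam k, hE.apply_eq k⟩) (fun x hx => by
      refine (hE.2.2 x).unique ?_
      convert hasSum_zero with k
      rw [hx _ ⟨k, rfl⟩, mul_zero, zero_smul])
  let j : ℕ → w := fun k => ⟨φ k, hw ⟨k, rfl⟩⟩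
  have hj : Function.Injective j := fun k l hkl =>
    hE.2.1.linearIndependent.injective (congrArg Subtype.val hkl)
  have haj : ∀ k, inner ℝ (b (j k)) (A (b (j k))) = lam k := fun k => by
    have : b (j k) = φ k := by rw [hb]
    rw [this, hE.apply_eq, inner_smul_right, real_inner_self_eq_norm_sq, hE.2.1.1 k]
    norm_num
  have ha0 : ∀ i, i ∉ Set.range j → inner ℝ (b i) (A (b i)) = 0 := fun i hi => by
    have : b i = (i : H) := by rw [hb]
    rw [this, hb0 i, inner_zero_right]
    rintro ⟨k, hk⟩
    exact hi ⟨k, Subtype.ext hk⟩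
  obtain ⟨C', hC', hsum⟩ := exists_sum_div_add_le hα hC.le hlam0 fun k => (hlam k).2
  refine ⟨w, b, _, hdiag, fun i => ?_, C', hC', fun ε hε hε1 s => ?_⟩
  · by_cases hi : i ∈ Set.range j
    · obtain ⟨k, rfl⟩ := hi
      rw [haj]
      exact hlam0 k
    · rw [ha0 i hi]
  · rw [← Finset.sum_preimage j s hj.injOn _ fun i _ hi => by rw [ha0 i hi, zero_div]]
    simp only [haj]
    exact hsum ε hε hε1 _

/-- A symmetric operator of finite rank has a Hilbert basis of eigenvectors. -/
lemma exists_isDiag_of_finiteDimensional [CompleteSpace H] {A : H →L[ℝ] H}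
    (hsymm : ∀ x y, inner ℝ (A x) y = inner ℝ x (A y)) (V : Submodule ℝ H)
    [FiniteDimensional ℝ V] (hV : ∀ x, A x ∈ V) :
    ∃ (w : Set H) (b : HilbertBasis w ℝ H), IsDiag b (fun i => inner ℝ (b i) (A (b i))) A := by
  let T : V →ₗ[ℝ] V := ((A : H →ₗ[ℝ] H).comp V.subtype).codRestrict V fun x => hV x
  have hT : T.IsSymmetric := fun x y => hsymm x y
  let e := hT.eigenvectorBasis rfl
  have hon : Orthonormal ℝ fun i => (e i : H) :=
    e.orthonormal.comp_linearIsometry V.subtypeₗᵢ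
  obtain ⟨w, b, -, -, -, hdiag⟩ := exists_isDiag_extension (A := A) hon.toSubtypeRange (by
      rintro _ ⟨i, rfl⟩
      refine ⟨hT.eigenvalues rfl i, ?_⟩
      exact congrArg Subtype.val (hT.apply_eigenvectorBasis rfl i)) (fun x hx => by
      have hx' : ∀ v : V, inner ℝ (v : H) x = 0 := fun v => by
        have h := congrArg Subtype.val (e.sum_repr v)
        rw [← h]
        push_cast
        rw [sum_inner]
        refine Finset.sum_eq_zero fun i _ => ?_
        rw [inner_smul_left, hx _ ⟨i, rfl⟩, mul_zero]
      rw [← inner_self_eq_zero (𝕜 := ℝ), hsymm, real_inner_comm]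
      exact hx' ⟨_, hV _⟩)
  exact ⟨w, b, hdiag⟩

/-- In a separable space, a Hilbert basis is countable. -/
lemma countable_of_hilbertBasis [TopologicalSpace.SeparableSpace H] {ι : Type*}
    (b : HilbertBasis ι ℝ H) : Countable ι := by
  have hd : Pairwise fun i j =>
      Disjoint (Metric.ball (b i) (1 / 2)) (Metric.ball (b j) (1 / 2)) := by
    intro i j hij
    refine Metric.ball_disjoint_ball ?_
    have h : ‖b i - b j‖ ^ 2 = 2 := by
      rw [norm_sub_sq_real, b.orthonormal.2 hij, b.orthonormal.1 i, b.orthonormal.1 j]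
      norm_num
    rw [dist_eq_norm]
    nlinarith [norm_nonneg (b i - b j)]
  exact Pairwise.countable_of_isOpen_disjoint hd (fun i => Metric.isOpen_ball)
    fun i => ⟨b i, Metric.mem_ball_self (by norm_num)⟩

end Eigenbases

/-! ### Second moments of averages in Hilbert spaces -/

section Probability

variable {Ω : Type*} [MeasurableSpace Ω] {P : Measure Ω} [IsProbabilityMeasure P]

/-- The variance of the mean of `n` i.i.d. Hilbert space valued variables is at most their second
moment divided by `n`. -/
lemma integral_norm_sq_mean_sub_le {S V : Type*} [MeasurableSpace S]
    [NormedAddCommGroup V] [InnerProductSpace ℝ V] [CompleteSpace V]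
    {W : ℕ → Ω → S} {W0 : Ω → S} (hindep : iIndepFun W P)
    (hident : ∀ i, IdentDistrib (W i) W0 P P) {G : S → V} (hG : StronglyMeasurable G) {C : ℝ}
    (hC : ∀ s, ‖G s‖ ≤ C) {n : ℕ} (hn : 0 < n) :
    ∫ ω, ‖(n : ℝ)⁻¹ • ∑ i ∈ Finset.range n, G (W i ω) - ∫ ω, G (W0 ω) ∂P‖ ^ 2 ∂P
      ≤ (n : ℝ)⁻¹ * ∫ ω, ‖G (W0 ω)‖ ^ 2 ∂P := by
  borelize V
  set c : V := ∫ ω, G (W0 ω) ∂P with hc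
  let U : S → V := fun s => G s - c
  have hU : StronglyMeasurable U := hG.sub stronglyMeasurable_const
  have hUb : ∀ s, ‖U s‖ ≤ C + ‖c‖ := fun s => (norm_sub_le _ _).trans (by gcongr; exact hC s)
  have hC0 : 0 ≤ C + ‖c‖ := by
    obtain ⟨ω⟩ := P.nonempty_of_neZero
    exact (norm_nonneg _).trans (hUb (W0 ω))
  have hUm : ∀ i, AEStronglyMeasurable (fun ω => U (W i ω)) P := fun i =>
    hU.aestronglyMeasurable.comp_aemeasurable (hident i).aemeasurable_fst
  have hUi : ∀ i, Integrable (fun ω => U (W i ω)) P := fun i =>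
    Integrable.of_bound (hUm i) (C + ‖c‖) (Eventually.of_forall fun ω => hUb _)
  have hG0 : Integrable (fun ω => G (W0 ω)) P :=
    Integrable.of_bound (hG.aestronglyMeasurable.comp_aemeasurable (hident 0).aemeasurable_snd) C
      (Eventually.of_forall fun ω => hC _)
  have hU0 : ∫ ω, U (W0 ω) ∂P = 0 := by
    simp only [U]
    rw [integral_sub hG0 (integrable_const _)]
    simp [hc]
  have hUz : ∀ i, ∫ ω, U (W i ω) ∂P = 0 := fun i => by
    rw [← hU0]
    exact ((hident i).comp hU.measurable).integral_eq
  have hij : ∀ i j, Integrable (fun ω => inner ℝ (U (W i ω)) (U (W j ω))) P := fun i j =>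
    Integrable.of_bound ((hUm i).inner (hUm j)) ((C + ‖c‖) * (C + ‖c‖))
      (Eventually.of_forall fun ω => by
        rw [Real.norm_eq_abs]
        exact (abs_real_inner_le_norm _ _).trans
          (mul_le_mul (hUb _) (hUb _) (norm_nonneg _) hC0))
  have hcross : ∀ i j, i ≠ j → ∫ ω, inner ℝ (U (W i ω)) (U (W j ω)) ∂P = 0 := fun i j h => by
    have hind : IndepFun (fun ω => U (W i ω)) (fun ω => U (W j ω)) P :=
      (hindep.indepFun h).comp hU.measurable hU.measurable
    refine (hind.integral_bilin (hUi i) (hUi j) (innerSL ℝ)).trans ?_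
    rw [hUz, hUz, map_zero]
  have hdiag : ∀ i, ∫ ω, inner ℝ (U (W i ω)) (U (W i ω)) ∂P ≤ ∫ ω, ‖G (W0 ω)‖ ^ 2 ∂P := fun i => by
    have h1 : ∫ ω, inner ℝ (U (W i ω)) (U (W i ω)) ∂P = ∫ ω, ‖U (W0 ω)‖ ^ 2 ∂P := by
      simp only [real_inner_self_eq_norm_sq]
      exact ((hident i).comp (u := fun s => ‖U s‖ ^ 2)
        (hU.norm.measurable.pow_const 2)).integral_eq
    have hGsq : Integrable (fun ω => ‖G (W0 ω)‖ ^ 2) P :=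
      Integrable.of_bound (hG0.1.norm.pow 2) (C ^ 2) (Eventually.of_forall fun ω => by
        rw [Real.norm_eq_abs, abs_of_nonneg (by positivity)]
        gcongr
        exact hC _)
    have h2 : ∫ ω, ‖U (W0 ω)‖ ^ 2 ∂P = ∫ ω, ‖G (W0 ω)‖ ^ 2 ∂P - ‖c‖ ^ 2 := by
      have h3 : ∀ ω, ‖U (W0 ω)‖ ^ 2
          = ‖G (W0 ω)‖ ^ 2 - 2 * inner ℝ c (G (W0 ω)) + ‖c‖ ^ 2 := fun ω => by
        rw [norm_sub_sq_real, real_inner_comm]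
      have h4 : Integrable (fun ω => ‖G (W0 ω)‖ ^ 2 - 2 * inner ℝ c (G (W0 ω))) P :=
        hGsq.sub ((hG0.const_inner c).const_mul 2)
      simp only [h3]
      rw [integral_add h4 (integrable_const _),
        integral_sub hGsq ((hG0.const_inner c).const_mul 2), integral_const_mul,
        integral_inner hG0, ← hc, real_inner_self_eq_norm_sq]
      simp
      ring
    rw [h1, h2]
    linarith [sq_nonneg ‖c‖]
  have hn0 : (0 : ℝ) < n := by exact_mod_cast hn
  have hexp : ∀ ω, ‖(n : ℝ)⁻¹ • ∑ i ∈ Finset.range n, G (W i ω) - c‖ ^ 2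
      = ((n : ℝ)⁻¹) ^ 2 * ∑ i ∈ Finset.range n, ∑ j ∈ Finset.range n,
        inner ℝ (U (W i ω)) (U (W j ω)) := fun ω => by
    have h1 : (n : ℝ)⁻¹ • ∑ i ∈ Finset.range n, G (W i ω) - c
        = (n : ℝ)⁻¹ • ∑ i ∈ Finset.range n, U (W i ω) := by
      simp only [U, Finset.sum_sub_distrib, Finset.sum_const, Finset.card_range, smul_sub]
      rw [← Nat.cast_smul_eq_nsmul ℝ, smul_smul, inv_mul_cancel₀ hn0.ne', one_smul]
    rw [h1, norm_smul, mul_pow, ← real_inner_self_eq_norm_sq (∑ i ∈ Finset.range n, U (W i ω)),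
      sum_inner]
    simp only [inner_sum]
    simp
  simp only [hexp]
  rw [integral_const_mul, integral_finsetSum _ fun i _ => integrable_finsetSum _ fun j _ => hij i j]
  calc ((n : ℝ)⁻¹) ^ 2 * ∑ i ∈ Finset.range n,
        ∫ ω, ∑ j ∈ Finset.range n, inner ℝ (U (W i ω)) (U (W j ω)) ∂P
      ≤ ((n : ℝ)⁻¹) ^ 2 * ∑ i ∈ Finset.range n, ∫ ω, ‖G (W0 ω)‖ ^ 2 ∂P := by
        refine mul_le_mul_of_nonneg_left (Finset.sum_le_sum fun i hi => ?_) (by positivity)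
        rw [integral_finsetSum _ fun j _ => hij i j,
          Finset.sum_eq_single i (fun j _ hj => hcross i j hj.symm) (fun h => absurd hi h)]
        exact hdiag i
    _ = _ := by
        rw [Finset.sum_const, Finset.card_range, nsmul_eq_mul]
        field_simp

end Probability

/-! ### Feature maps of bounded continuous kernels -/

section Kernel

variable {S H : Type*} [TopologicalSpace S] [NormedAddCommGroup H] [InnerProductSpace ℝ H]
  [CompleteSpace H] [RKHS ℝ H S ℝ]

omit [TopologicalSpace S] in
lemma inner_feat (x y : S) : inner ℝ (feat H x) (feat H y) = kappa H x y := by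
  have h := RKHS.kernel_inner H x y (1 : ℝ) (1 : ℝ)
  rw [feat, feat, kappa, real_inner_comm, ← h]
  simp

lemma continuous_feat (hk : BoundedContinuousKernel H) : Continuous (feat H : S → H) := by
  rw [continuous_iff_continuousAt]
  intro x
  rw [ContinuousAt, tendsto_iff_norm_sub_tendsto_zero]
  have h : ∀ y, ‖feat H y - feat H x‖
      = √(kappa H y y - 2 * kappa H y x + kappa H x x) := fun y => by
    rw [← inner_feat, ← inner_feat, ← inner_feat, real_inner_self_eq_norm_sq,
      real_inner_self_eq_norm_sq, ← norm_sub_sq_real, Real.sqrt_sq (norm_nonneg _)]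
  have hc := hk.2
  have hcont : Continuous fun y : S => √(kappa H y y - 2 * kappa H y x + kappa H x x) := by
    have h1 : Continuous fun y : S => kappa H y y :=
      hc.comp (f := fun y => (y, y)) (by fun_prop)
    have h2 : Continuous fun y : S => kappa H y x :=
      hc.comp (f := fun y => (y, x)) (by fun_prop)
    fun_prop
  simp only [h]
  have := hcont.tendsto x
  simp only [show kappa H x x - 2 * kappa H x x + kappa H x x = 0 by ring, Real.sqrt_zero] at this
  exact this

lemma exists_norm_feat_le (hk : BoundedContinuousKernel H) :
    ∃ C : ℝ, 0 ≤ C ∧ ∀ x : S, ‖feat H x‖ ≤ C := by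
  obtain ⟨C, hC⟩ := hk.1
  refine ⟨√C, Real.sqrt_nonneg _, fun x => ?_⟩
  rw [← Real.sqrt_sq (norm_nonneg (feat H x)), ← real_inner_self_eq_norm_sq, inner_feat]
  exact Real.sqrt_le_sqrt ((le_abs_self _).trans (hC x x))

/-- Separability makes the eigenbasis of `Σ_XX` countable, so that the expected Hilbert-Schmidt
norms may be computed term by term. -/
lemma separableSpace_of_continuous_kernel [TopologicalSpace.SeparableSpace S]
    (hk : BoundedContinuousKernel H) : TopologicalSpace.SeparableSpace H := by
  have h1 : TopologicalSpace.IsSeparable (Set.range (feat H : S → H)) :=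
    TopologicalSpace.isSeparable_range (continuous_feat hk)
  have h2 := (h1.span (R := ℝ)).closure
  rw [← TopologicalSpace.isSeparable_univ_iff]
  refine h2.mono fun x _ => ?_
  have hd := RKHS.kerFun_dense (𝕜 := ℝ) H (X := S) (V := ℝ)
  have hx : x ∈ (Submodule.span ℝ {RKHS.kerFun H x v | (x : S) (v : ℝ)}).topologicalClosure := by
    rw [hd]; trivial
  refine closure_mono ?_ hx
  refine Submodule.span_le.2 ?_
  rintro _ ⟨y, v, rfl⟩
  have : RKHS.kerFun H y v = v • feat H y := by
    rw [feat, ← map_smul, smul_eq_mul, mul_one]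
  rw [this]
  exact Submodule.smul_mem _ _ (Submodule.subset_span ⟨y, rfl⟩)

end Kernel

/-! ### Sample and population covariance operators -/

section CovarianceOperators

variable {Ω : Type*} [MeasurableSpace Ω] {P : Measure Ω} [IsProbabilityMeasure P]
  {S T H K : Type*}
  [NormedAddCommGroup H] [InnerProductSpace ℝ H] [CompleteSpace H] [RKHS ℝ H S ℝ]
  [NormedAddCommGroup K] [InnerProductSpace ℝ K] [CompleteSpace K] [RKHS ℝ K T ℝ]

/-- The sample covariance operator may be computed with any centers `m`, `m'` in place of the
sample means, at the price of a rank one correction. -/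
lemma inner_crossCovHat_apply {n : ℕ} (hn : 0 < n) (x : ℕ → S) (y : ℕ → T) (m : H) (m' : K)
    (v : H) (g : K) :
    inner ℝ v (crossCovHat H K n x y g)
      = inner ℝ ((n : ℝ)⁻¹ • ∑ i ∈ Finset.range n, inner ℝ v (feat H (x i) - m) •
            (feat K (y i) - m')
          - inner ℝ v ((n : ℝ)⁻¹ • ∑ i ∈ Finset.range n, (feat H (x i) - m)) •
            ((n : ℝ)⁻¹ • ∑ i ∈ Finset.range n, (feat K (y i) - m'))) g := by
  have hn0 : (n : ℝ) ≠ 0 := by positivity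
  set p := fun i => inner ℝ v (feat H (x i)) with hp
  set r := fun i => inner ℝ (feat K (y i)) g with hr
  have hL : inner ℝ v (crossCovHat H K n x y g) = (n : ℝ)⁻¹ * ∑ i ∈ Finset.range n,
      (p i - (n : ℝ)⁻¹ * ∑ j ∈ Finset.range n, p j) *
        (r i - (n : ℝ)⁻¹ * ∑ j ∈ Finset.range n, r j) := by
    simp only [crossCovHat, meanHat, smul_apply, sum_apply, rankOne_apply,
      inner_smul_right, inner_sum, inner_sub_right, hp, hr, inner_sub_left, inner_smul_left,
      sum_inner]
    congr 1
    refine Finset.sum_congr rfl fun i _ => ?_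
    simp
    ring
  have hR : inner ℝ ((n : ℝ)⁻¹ • ∑ i ∈ Finset.range n, inner ℝ v (feat H (x i) - m) •
            (feat K (y i) - m')
          - inner ℝ v ((n : ℝ)⁻¹ • ∑ i ∈ Finset.range n, (feat H (x i) - m)) •
            ((n : ℝ)⁻¹ • ∑ i ∈ Finset.range n, (feat K (y i) - m'))) g
      = (n : ℝ)⁻¹ * ∑ i ∈ Finset.range n, (p i - inner ℝ v m) * (r i - inner ℝ m' g)
        - ((n : ℝ)⁻¹ * ∑ i ∈ Finset.range n, (p i - inner ℝ v m)) *
          ((n : ℝ)⁻¹ * ∑ i ∈ Finset.range n, (r i - inner ℝ m' g)) := by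
    simp only [inner_sub_left, inner_smul_left, inner_smul_right, sum_inner, inner_sum,
      inner_sub_right, hp, hr]
    simp
  rw [hL, hR]
  generalize inner ℝ v m = c
  generalize inner ℝ m' g = c'
  simp only [sub_mul, mul_sub, Finset.sum_sub_distrib, ← Finset.sum_mul, ← Finset.mul_sum,
    Finset.sum_const, Finset.card_range, nsmul_eq_mul]
  field_simp
  ring

end CovarianceOperators

section SampleError

variable {Ω : Type*} [MeasurableSpace Ω] {P : Measure Ω} [IsProbabilityMeasure P]
  {S T H K : Type*}
  [NormedAddCommGroup H] [InnerProductSpace ℝ H] [CompleteSpace H] [RKHS ℝ H S ℝ]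
  [NormedAddCommGroup K] [InnerProductSpace ℝ K] [CompleteSpace K] [RKHS ℝ K T ℝ]

lemma norm_mean_le {E : Type*} [NormedAddCommGroup E] [NormedSpace ℝ E] {n : ℕ} (hn : 0 < n)
    {u : ℕ → E} {B : ℝ} (hu : ∀ i, ‖u i‖ ≤ B) :
    ‖(n : ℝ)⁻¹ • ∑ i ∈ Finset.range n, u i‖ ≤ B := by
  have hn0 : (0 : ℝ) < n := by exact_mod_cast hn
  rw [norm_smul, norm_inv, Real.norm_natCast, inv_mul_le_iff₀ hn0]
  refine (norm_sum_le_of_le _ fun i _ => hu i).trans ?_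
  simp

lemma integrable_norm_sq_mean_sub {S E : Type*} [MeasurableSpace S] [NormedAddCommGroup E]
    [NormedSpace ℝ E] {W : ℕ → Ω → S} {W0 : Ω → S} (hid : ∀ i, IdentDistrib (W i) W0 P P)
    {F : S → E} {B : ℝ} (hF : StronglyMeasurable F) (hB : ∀ w, ‖F w‖ ≤ B)
    {n : ℕ} (hn : 0 < n) (c : E) :
    Integrable (fun ω => ‖(n : ℝ)⁻¹ • ∑ i ∈ Finset.range n, F (W i ω) - c‖ ^ 2) P := by
  refine Integrable.of_bound ?_ ((B + ‖c‖) ^ 2) (Eventually.of_forall fun ω => ?_)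
  · exact (((Finset.aestronglyMeasurable_fun_sum _ fun i _ =>
      hF.aestronglyMeasurable.comp_aemeasurable (hid i).aemeasurable_fst).const_smul _).sub
      aestronglyMeasurable_const).norm.pow 2
  · rw [Real.norm_eq_abs, abs_of_nonneg (by positivity)]
    gcongr
    exact (norm_sub_le _ _).trans (by gcongr; exact norm_mean_le hn fun i => hB _)

/-- The adjoint of `Σ̂ - Σ` at `v`: a centered mean of the variables `⟨v, ξ⟩ η`, where `ξ` and `η`
are the centered features, minus the correction for the estimated centers. -/
def covError (H K : Type*) [NormedAddCommGroup H] [InnerProductSpace ℝ H] [CompleteSpace H]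
    [RKHS ℝ H S ℝ] [NormedAddCommGroup K] [InnerProductSpace ℝ K] [CompleteSpace K]
    [RKHS ℝ K T ℝ] (P : Measure Ω) (X : Ω → S) (Y : Ω → T) (n : ℕ) (x : ℕ → S) (y : ℕ → T)
    (v : H) : K :=
  ((n : ℝ)⁻¹ • ∑ i ∈ Finset.range n, inner ℝ v (feat H (x i) - meanElt H P X) •
        (feat K (y i) - meanElt K P Y)
      - ∫ ω, inner ℝ v (feat H (X ω) - meanElt H P X) • (feat K (Y ω) - meanElt K P Y) ∂P)
    - inner ℝ v ((n : ℝ)⁻¹ • ∑ i ∈ Finset.range n, (feat H (x i) - meanElt H P X)) •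
      ((n : ℝ)⁻¹ • ∑ i ∈ Finset.range n, (feat K (y i) - meanElt K P Y))

variable [TopologicalSpace S] [SecondCountableTopology S] [MeasurableSpace S]
  [OpensMeasurableSpace S] [TopologicalSpace T] [SecondCountableTopology T] [MeasurableSpace T]
  [OpensMeasurableSpace T]
  {X : Ω → S} {Y : Ω → T}

lemma stronglyMeasurable_feat_sub (hk : BoundedContinuousKernel (S := S) H) (m : H) :
    StronglyMeasurable fun x : S => feat H x - m :=
  (continuous_feat hk).stronglyMeasurable.sub stronglyMeasurable_const

omit [SecondCountableTopology S] [MeasurableSpace S] [OpensMeasurableSpace S] in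
lemma exists_norm_feat_sub_le (hk : BoundedContinuousKernel (S := S) H) (m : H) :
    ∃ C : ℝ, 0 ≤ C ∧ ∀ x : S, ‖feat H x - m‖ ≤ C := by
  obtain ⟨C, hC0, hC⟩ := exists_norm_feat_le hk
  exact ⟨C + ‖m‖, by positivity, fun x => (norm_sub_le _ _).trans (by gcongr; exact hC x)⟩

lemma integrable_feat_sub (hk : BoundedContinuousKernel (S := S) H) (hX : Measurable X) (m : H) :
    Integrable (fun ω => feat H (X ω) - m) P := by
  obtain ⟨C, -, hC⟩ := exists_norm_feat_sub_le hk m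
  exact Integrable.of_bound
    ((stronglyMeasurable_feat_sub hk m).comp_measurable hX).aestronglyMeasurable C
    (Eventually.of_forall fun ω => hC _)

lemma integral_feat_sub_mean (hk : BoundedContinuousKernel (S := S) H) (hX : Measurable X) :
    ∫ ω, feat H (X ω) - meanElt H P X ∂P = 0 := by
  have h : Integrable (fun ω => feat H (X ω)) P := by
    simpa using integrable_feat_sub (P := P) hk hX 0
  rw [integral_sub h (integrable_const _)]
  simp [meanElt]

lemma inner_crossCov_apply (hkH : BoundedContinuousKernel (S := S) H)
    (hkK : BoundedContinuousKernel (S := T) K) (hX : Measurable X) (hY : Measurable Y)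
    (v : H) (g : K) :
    inner ℝ v (crossCov H K P X Y g)
      = inner ℝ (∫ ω, inner ℝ v (feat H (X ω) - meanElt H P X) •
          (feat K (Y ω) - meanElt K P Y) ∂P) g := by
  obtain ⟨C, hC0, hC⟩ := exists_norm_feat_sub_le hkH (meanElt H P X)
  obtain ⟨D, hD0, hD⟩ := exists_norm_feat_sub_le hkK (meanElt K P Y)
  have hξ := ((stronglyMeasurable_feat_sub hkH (meanElt H P X)).comp_measurable hX)
  have hη := ((stronglyMeasurable_feat_sub hkK (meanElt K P Y)).comp_measurable hY)
  have h1 : Integrable (fun ω => rankOne ℝ (feat H (X ω) - meanElt H P X)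
      (feat K (Y ω) - meanElt K P Y)) P := by
    refine Integrable.of_bound ?_ (C * D) (Eventually.of_forall fun ω => ?_)
    · have hc : Continuous fun z : H × K => (rankOne ℝ z.1 z.2 : K →L[ℝ] H) :=
        (rankOne ℝ : H →L[ℝ] K →L⋆[ℝ] K →L[ℝ] H).continuous₂
      exact (hc.comp_stronglyMeasurable (hξ.prodMk hη)).aestronglyMeasurable
    · rw [norm_rankOne]
      exact mul_le_mul (hC _) (hD _) (norm_nonneg _) hC0
  have h2 : Integrable (fun ω => inner ℝ v (feat H (X ω) - meanElt H P X) •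
      (feat K (Y ω) - meanElt K P Y)) P := by
    refine Integrable.of_bound ?_ (‖v‖ * C * D) (Eventually.of_forall fun ω => ?_)
    · exact ((stronglyMeasurable_const.inner hξ).smul hη).aestronglyMeasurable
    · rw [norm_smul, Real.norm_eq_abs]
      refine mul_le_mul ((abs_real_inner_le_norm _ _).trans ?_) (hD _) (norm_nonneg _)
        (by positivity)
      gcongr
      exact hC _
  rw [crossCov, ContinuousLinearMap.integral_apply h1,
    ← integral_inner (h1.apply_continuousLinearMap g), real_inner_comm, ← integral_inner h2]
  refine integral_congr_ae (Eventually.of_forall fun ω => ?_)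
  simp only [rankOne_apply, inner_smul_right]
  rw [real_inner_comm]
  ring

lemma inner_crossCov_self (hkH : BoundedContinuousKernel (S := S) H) (hX : Measurable X) (v : H) :
    inner ℝ v (crossCov H H P X X v)
      = ∫ ω, inner ℝ v (feat H (X ω) - meanElt H P X) ^ 2 ∂P := by
  obtain ⟨C, hC0, hC⟩ := exists_norm_feat_sub_le hkH (meanElt H P X)
  have hξ := ((stronglyMeasurable_feat_sub hkH (meanElt H P X)).comp_measurable hX)
  have h2 : Integrable (fun ω => inner ℝ v (feat H (X ω) - meanElt H P X) •
      (feat H (X ω) - meanElt H P X)) P := by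
    refine Integrable.of_bound ?_ (‖v‖ * C * C) (Eventually.of_forall fun ω => ?_)
    · exact ((stronglyMeasurable_const.inner hξ).smul hξ).aestronglyMeasurable
    · rw [norm_smul, Real.norm_eq_abs]
      refine mul_le_mul ((abs_real_inner_le_norm _ _).trans ?_) (hC _) (norm_nonneg _)
        (by positivity)
      gcongr
      exact hC _
  rw [inner_crossCov_apply hkH hkH hX hX, real_inner_comm, ← integral_inner h2]
  refine integral_congr_ae (Eventually.of_forall fun ω => ?_)
  simp only [inner_smul_right]
  ring

lemma inner_crossCovHat_sub_apply (hkH : BoundedContinuousKernel (S := S) H)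
    (hkK : BoundedContinuousKernel (S := T) K) (hX : Measurable X) (hY : Measurable Y)
    {n : ℕ} (hn : 0 < n) (x : ℕ → S) (y : ℕ → T) (v : H) (g : K) :
    inner ℝ v ((crossCovHat H K n x y - crossCov H K P X Y) g)
      = inner ℝ (covError H K P X Y n x y v) g := by
  rw [sub_apply, inner_sub_right, inner_crossCov_apply hkH hkK hX hY,
    inner_crossCovHat_apply hn x y (meanElt H P X) (meanElt K P Y), ← inner_sub_left, covError]
  congr 1
  abel

omit [IsProbabilityMeasure P] in
lemma aestronglyMeasurable_covError (hkH : BoundedContinuousKernel (S := S) H)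
    (hkK : BoundedContinuousKernel (S := T) K) {Xs : ℕ → Ω → S} {Ys : ℕ → Ω → T}
    (hid : ∀ i, IdentDistrib (fun ω => (Xs i ω, Ys i ω)) (fun ω => (X ω, Y ω)) P P)
    (n : ℕ) (v : H) :
    AEStronglyMeasurable
      (fun ω => covError H K P X Y n (fun i => Xs i ω) (fun i => Ys i ω) v) P := by
  have hξ : ∀ i, AEStronglyMeasurable (fun ω => feat H (Xs i ω) - meanElt H P X) P := fun i =>
    (stronglyMeasurable_feat_sub hkH _).aestronglyMeasurable.comp_aemeasurable
      (measurable_fst.comp_aemeasurable (hid i).aemeasurable_fst)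
  have hη : ∀ i, AEStronglyMeasurable (fun ω => feat K (Ys i ω) - meanElt K P Y) P := fun i =>
    (stronglyMeasurable_feat_sub hkK _).aestronglyMeasurable.comp_aemeasurable
      (measurable_snd.comp_aemeasurable (hid i).aemeasurable_fst)
  refine AEStronglyMeasurable.sub (AEStronglyMeasurable.sub ?_ aestronglyMeasurable_const)
    (AEStronglyMeasurable.smul ?_ ?_)
  · exact (Finset.aestronglyMeasurable_fun_sum _ fun i _ =>
      (aestronglyMeasurable_const.inner (hξ i)).smul (hη i)).const_smul _
  · exact aestronglyMeasurable_const.inner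
      ((Finset.aestronglyMeasurable_fun_sum _ fun i _ => hξ i).const_smul _)
  · exact (Finset.aestronglyMeasurable_fun_sum _ fun i _ => hη i).const_smul _

omit [TopologicalSpace S] [SecondCountableTopology S] [MeasurableSpace S]
  [OpensMeasurableSpace S] [TopologicalSpace T] [SecondCountableTopology T] [MeasurableSpace T]
  [OpensMeasurableSpace T] [IsProbabilityMeasure P] in
lemma norm_sq_covError_le {D : ℝ} (hD : ∀ y : T, ‖feat K y - meanElt K P Y‖ ≤ D)
    {n : ℕ} (hn : 0 < n) (x : ℕ → S) (y : ℕ → T) (v : H) :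
    ‖covError H K P X Y n x y v‖ ^ 2
      ≤ 2 * ‖(n : ℝ)⁻¹ • ∑ i ∈ Finset.range n, inner ℝ v (feat H (x i) - meanElt H P X) •
            (feat K (y i) - meanElt K P Y)
          - ∫ ω, inner ℝ v (feat H (X ω) - meanElt H P X) •
            (feat K (Y ω) - meanElt K P Y) ∂P‖ ^ 2
        + 2 * D ^ 2 * inner ℝ v ((n : ℝ)⁻¹ • ∑ i ∈ Finset.range n,
            (feat H (x i) - meanElt H P X)) ^ 2 := by
  have hb := norm_mean_le hn fun i => hD (y i)
  refine (pow_le_pow_left₀ (norm_nonneg _) (norm_sub_le _ _) 2).trans ?_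
  rw [norm_smul, Real.norm_eq_abs]
  set p := ‖(n : ℝ)⁻¹ • ∑ i ∈ Finset.range n, inner ℝ v (feat H (x i) - meanElt H P X) •
      (feat K (y i) - meanElt K P Y)
    - ∫ ω, inner ℝ v (feat H (X ω) - meanElt H P X) • (feat K (Y ω) - meanElt K P Y) ∂P‖
  set r := inner ℝ v ((n : ℝ)⁻¹ • ∑ i ∈ Finset.range n, (feat H (x i) - meanElt H P X))
  have h1 : (|r| * ‖(n : ℝ)⁻¹ • ∑ i ∈ Finset.range n, (feat K (y i) - meanElt K P Y)‖) ^ 2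
      ≤ r ^ 2 * D ^ 2 := by
    rw [mul_pow, sq_abs]
    gcongr
  refine (add_sq_le).trans ?_
  linarith

/-- The estimated centers only cost a factor in the constant: one of the two factors of the
correction is bounded, the other is a centered mean. -/
lemma lintegral_norm_sq_covError_le (hkH : BoundedContinuousKernel (S := S) H)
    (hkK : BoundedContinuousKernel (S := T) K) (hX : Measurable X)
    {Xs : ℕ → Ω → S} {Ys : ℕ → Ω → T}
    (hindep : iIndepFun (fun i ω => (Xs i ω, Ys i ω)) P)
    (hid : ∀ i, IdentDistrib (fun ω => (Xs i ω, Ys i ω)) (fun ω => (X ω, Y ω)) P P)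
    {D : ℝ} (hD : ∀ y : T, ‖feat K y - meanElt K P Y‖ ≤ D)
    {n : ℕ} (hn : 0 < n) (v : H) :
    ∫⁻ ω, ENNReal.ofReal (‖covError H K P X Y n (fun i => Xs i ω) (fun i => Ys i ω) v‖ ^ 2) ∂P
      ≤ ENNReal.ofReal (4 * D ^ 2 * (n : ℝ)⁻¹ * inner ℝ v (crossCov H H P X X v)) := by
  obtain ⟨C, hC0, hC⟩ := exists_norm_feat_sub_le hkH (meanElt H P X)
  have hn0 : (0 : ℝ) < n := by exact_mod_cast hn
  have hξ := stronglyMeasurable_feat_sub hkH (meanElt H P X)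
  have hη := stronglyMeasurable_feat_sub hkK (meanElt K P Y)
  let G : S × T → K := fun w =>
    inner ℝ v (feat H w.1 - meanElt H P X) • (feat K w.2 - meanElt K P Y)
  let L : S × T → ℝ := fun w => inner ℝ v (feat H w.1 - meanElt H P X)
  have hLm : StronglyMeasurable L :=
    stronglyMeasurable_const.inner (hξ.comp_measurable measurable_fst)
  have hGm : StronglyMeasurable G := hLm.smul (hη.comp_measurable measurable_snd)
  have hLb : ∀ w, ‖L w‖ ≤ ‖v‖ * C := fun w => by
    rw [Real.norm_eq_abs]
    exact (abs_real_inner_le_norm _ _).trans (by gcongr; exact hC _)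
  have hGb : ∀ w, ‖G w‖ ≤ ‖v‖ * C * D := fun w => by
    rw [norm_smul]
    exact mul_le_mul (hLb w) (hD _) (norm_nonneg _) (by positivity)
  have hGv := integral_norm_sq_mean_sub_le hindep hid hGm hGb hn
  have hLv := integral_norm_sq_mean_sub_le hindep hid hLm hLb hn
  have hL0 : ∫ ω, L (X ω, Y ω) ∂P = 0 := by
    simp only [L]
    rw [integral_inner (integrable_feat_sub hkH hX _), integral_feat_sub_mean hkH hX,
      inner_zero_right]
  have hσ : ∫ ω, ‖L (X ω, Y ω)‖ ^ 2 ∂P = inner ℝ v (crossCov H H P X X v) := by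
    rw [inner_crossCov_self hkH hX]
    simp only [L, Real.norm_eq_abs, sq_abs]
  have hLi : Integrable (fun ω => ‖L (X ω, Y ω)‖ ^ 2) P := by
    refine Integrable.of_bound ?_ ((‖v‖ * C) ^ 2) (Eventually.of_forall fun ω => ?_)
    · exact (hLm.aestronglyMeasurable.comp_aemeasurable (hid 0).aemeasurable_snd).norm.pow 2
    · rw [Real.norm_eq_abs, abs_of_nonneg (by positivity)]
      gcongr
      exact hLb _
  have hGσ : ∫ ω, ‖G (X ω, Y ω)‖ ^ 2 ∂P ≤ D ^ 2 * inner ℝ v (crossCov H H P X X v) := by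
    rw [← hσ, ← integral_const_mul]
    refine integral_mono_of_nonneg (Eventually.of_forall fun ω => by positivity)
      (hLi.const_mul _) (Eventually.of_forall fun ω => ?_)
    simp only [G, L, norm_smul, mul_pow]
    rw [mul_comm]
    gcongr
    exact hD _
  set a : Ω → ℝ := fun ω => ‖(n : ℝ)⁻¹ • ∑ i ∈ Finset.range n, G (Xs i ω, Ys i ω)
    - ∫ ω, G (X ω, Y ω) ∂P‖ ^ 2 with ha
  set l : Ω → ℝ := fun ω => ‖(n : ℝ)⁻¹ • ∑ i ∈ Finset.range n, L (Xs i ω, Ys i ω)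
    - ∫ ω, L (X ω, Y ω) ∂P‖ ^ 2 with hl
  have hpt : ∀ ω, ‖covError H K P X Y n (fun i => Xs i ω) (fun i => Ys i ω) v‖ ^ 2
      ≤ 2 * a ω + 2 * D ^ 2 * l ω := fun ω => by
    have hlω : l ω = inner ℝ v ((n : ℝ)⁻¹ • ∑ i ∈ Finset.range n,
        (feat H (Xs i ω) - meanElt H P X)) ^ 2 := by
      simp only [hl]
      rw [hL0, sub_zero, inner_smul_right, inner_sum, Real.norm_eq_abs, sq_abs, smul_eq_mul]
    rw [hlω]
    exact norm_sq_covError_le hD hn _ _ v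
  have hai : Integrable a P := integrable_norm_sq_mean_sub hid hGm hGb hn _
  have hli : Integrable l P := integrable_norm_sq_mean_sub hid hLm hLb hn _
  calc _ ≤ ∫⁻ ω, ENNReal.ofReal (2 * a ω + 2 * D ^ 2 * l ω) ∂P :=
        lintegral_mono fun ω => ENNReal.ofReal_le_ofReal (hpt ω)
    _ = ENNReal.ofReal (∫ ω, 2 * a ω + 2 * D ^ 2 * l ω ∂P) := by
        have hi : Integrable (fun ω => 2 * a ω + 2 * D ^ 2 * l ω) P :=
          (hai.const_mul 2).add (hli.const_mul _)
        rw [ofReal_integral_eq_lintegral_ofReal hi]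
        exact Eventually.of_forall fun ω => by
          simp only [ha, hl, Pi.zero_apply]
          positivity
    _ ≤ _ := by
        refine ENNReal.ofReal_le_ofReal ?_
        rw [integral_add (hai.const_mul 2) (hli.const_mul _), integral_const_mul,
          integral_const_mul]
        rw [hσ] at hLv
        have h1 : ∫ ω, a ω ∂P
            ≤ (n : ℝ)⁻¹ * (D ^ 2 * inner ℝ v (crossCov H H P X X v)) :=
          hGv.trans (by gcongr)
        have h2 : 2 * D ^ 2 * ∫ ω, l ω ∂P
            ≤ 2 * D ^ 2 * ((n : ℝ)⁻¹ * inner ℝ v (crossCov H H P X X v)) := by gcongr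
        linarith

omit [IsProbabilityMeasure P] in
/-- Markov's inequality for the sum of weighted squares, which is finite almost surely. -/
lemma measure_not_sum_le_le {ι E : Type*} [Countable ι] [NormedAddCommGroup E] {z : ι → Ω → E}
    (hz : ∀ i, AEStronglyMeasurable (z i) P) {γ a : ι → ℝ} (hγ : ∀ i, 0 < γ i)
    (ha : ∀ i, 0 ≤ a i) {c D r : ℝ} (hc : 0 ≤ c)
    (hza : ∀ i, ∫⁻ ω, ENNReal.ofReal (‖z i ω‖ ^ 2) ∂P ≤ ENNReal.ofReal (c * a i))
    (hD : ∀ s : Finset ι, ∑ i ∈ s, a i / γ i ≤ D) (hr : 0 < r) :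
    P {ω | ¬ ∀ s : Finset ι, ∑ i ∈ s, ‖z i ω‖ ^ 2 / γ i ≤ r} ≤ ENNReal.ofReal (c * D / r) := by
  have hm : ∀ i, AEMeasurable (fun ω => ENNReal.ofReal (‖z i ω‖ ^ 2 / γ i)) P := fun i =>
    ((((hz i).norm.pow 2).aemeasurable).div_const _).ennreal_ofReal
  have hsub : {ω | ¬ ∀ s : Finset ι, ∑ i ∈ s, ‖z i ω‖ ^ 2 / γ i ≤ r}
      ⊆ {ω | ENNReal.ofReal r ≤ ∑' i, ENNReal.ofReal (‖z i ω‖ ^ 2 / γ i)} := by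
    intro ω hω
    simp only [Set.mem_ofPred_eq, not_forall, not_le] at hω ⊢
    obtain ⟨s, hs⟩ := hω
    refine (ENNReal.ofReal_le_ofReal hs.le).trans ?_
    rw [ENNReal.ofReal_sum_of_nonneg fun i _ => div_nonneg (sq_nonneg _) (hγ i).le]
    exact ENNReal.sum_le_tsum s
  have hint : ∫⁻ ω, ∑' i, ENNReal.ofReal (‖z i ω‖ ^ 2 / γ i) ∂P ≤ ENNReal.ofReal (c * D) := by
    rw [lintegral_tsum hm, ENNReal.tsum_eq_iSup_sum]
    refine iSup_le fun s => ?_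
    calc ∑ i ∈ s, ∫⁻ ω, ENNReal.ofReal (‖z i ω‖ ^ 2 / γ i) ∂P
        ≤ ∑ i ∈ s, ENNReal.ofReal (c * (a i / γ i)) := by
          refine Finset.sum_le_sum fun i _ => ?_
          have h1 : ∀ ω, ENNReal.ofReal (‖z i ω‖ ^ 2 / γ i)
              = ENNReal.ofReal (γ i)⁻¹ * ENNReal.ofReal (‖z i ω‖ ^ 2) := fun ω => by
            rw [← ENNReal.ofReal_mul (inv_nonneg.2 (hγ i).le)]
            congr 1
            ring
          simp only [h1]
          rw [lintegral_const_mul' _ _ ENNReal.ofReal_ne_top]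
          refine (mul_le_mul_right (hza i) _).trans ?_
          rw [← ENNReal.ofReal_mul (inv_nonneg.2 (hγ i).le)]
          refine ENNReal.ofReal_le_ofReal (le_of_eq ?_)
          ring
      _ = ENNReal.ofReal (c * ∑ i ∈ s, a i / γ i) := by
          rw [Finset.mul_sum, ENNReal.ofReal_sum_of_nonneg fun i _ =>
            mul_nonneg hc (div_nonneg (ha i) (hγ i).le)]
      _ ≤ _ := by
          gcongr
          exact hD s
  refine (measure_mono hsub).trans ?_
  refine (meas_ge_le_lintegral_div (AEMeasurable.tsum hm)
    (ENNReal.ofReal_pos.2 hr).ne' ENNReal.ofReal_ne_top).trans ?_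
  rw [ENNReal.ofReal_div_of_pos hr]
  gcongr

end SampleError

/-! ### Moore-Penrose inverses of diagonal operators -/

section MoorePenrose

variable {E F G : Type*} [NormedAddCommGroup E] [InnerProductSpace ℝ E]
  [NormedAddCommGroup F] [InnerProductSpace ℝ F] [NormedAddCommGroup G] [InnerProductSpace ℝ G]

lemma mem_graph_moorePenrose {A : E →L[ℝ] F} {x : E} (hx : x ∈ ((A : E →ₗ[ℝ] F).ker)ᗮ) :
    (A x, x) ∈ (moorePenrose A).graph := by
  refine LinearPMap.mem_inverse_graph
    (f := (A : E →ₗ[ℝ] F).toPMap ((A : E →ₗ[ℝ] F).ker)ᗮ) ?_ ⟨x, hx⟩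
  refine (Submodule.eq_bot_iff _).2 fun y hy => ?_
  have h1 : (y : E) ∈ (A : E →ₗ[ℝ] F).ker := hy
  have h2 := y.2 _ h1
  exact Subtype.ext (inner_self_eq_zero.1 h2)

lemma IsMPComp.eq_mpComp {A : E →L[ℝ] F} {B : G →L[ℝ] F} {R : G →L[ℝ] E} (hR : IsMPComp A B R) :
    mpComp A B = R := by
  have h : ∃ R, IsMPComp A B R := ⟨R, hR⟩
  rw [mpComp, dif_pos h]
  ext g
  exact LinearPMap.mem_graph_snd_inj _ (h.choose_spec g) (hR g) rfl

/-- If `V = A U` with `A`, `U` diagonal in one basis and `U` vanishing on `ker A`, then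
`A† (V S) = U S`. -/
lemma isMPComp_of_isDiag {ι : Type*} {b : HilbertBasis ι ℝ E} {f g : ι → ℝ} {A U V : E →L[ℝ] E}
    (hA : IsDiag b f A) (hU : IsDiag b g U) (hV : IsDiag b (fun i => f i * g i) V)
    (hfg : ∀ i, f i = 0 → g i = 0) (S : G →L[ℝ] E) : IsMPComp A (V ∘L S) (U ∘L S) := by
  intro w
  have h1 : (V ∘L S) w = A ((U ∘L S) w) := by
    rw [hV.unique (hA.comp hU) fun _ => rfl]
    rfl
  rw [h1]
  refine mem_graph_moorePenrose fun y hy => ?_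
  have hy' : A y = 0 := hy
  refine (b.hasSum_inner_mul_inner y ((U ∘L S) w)).unique ?_
  convert hasSum_zero with i
  rw [ContinuousLinearMap.comp_apply, hU.inner_apply]
  have h2 := hA.inner_apply i y
  rw [hy', inner_zero_right] at h2
  rcases mul_eq_zero.1 h2.symm with h | h
  · rw [hfg i h]; ring
  · rw [real_inner_comm, h]; ring

end MoorePenrose

/-! ### The error on the event where the sample covariances are close -/

section Deterministic

variable {ι κ H K : Type*} [NormedAddCommGroup H] [InnerProductSpace ℝ H] [CompleteSpace H]
  [NormedAddCommGroup K] [InnerProductSpace ℝ K]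

/-- Splits `A^{-1/2} Ĉ - R` with `C = G S`, `R = Gh S` into
`A^{-1/2} (Ĉ - C) + (A^{-1/2} - B^{-1/2}) C + (B^{-1/2} G - Gh) S`. -/
lemma norm_opPow_comp_sub_le {b : HilbertBasis ι ℝ H} {e : HilbertBasis κ ℝ H}
    {a : ι → ℝ} {ν : κ → ℝ} {Q Qh G Gh : H →L[ℝ] H} {Ch S : K →L[ℝ] H} {β ε δ L : ℝ}
    {z : ι → H} {z' : ι → K}
    (hQ : IsDiag b a Q) (hQh : IsDiag e ν Qh) (ha : ∀ i, 0 ≤ a i) (hν : ∀ k, 0 ≤ ν k)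
    (haL : ∀ i, a i ≤ L) (hL : 0 ≤ L) (hβ : 0 < β) (hε : 0 < ε)
    (hG : IsDiag b (fun i => a i ^ (1 + β)) G) (hGh : IsDiag b (fun i => a i ^ (β + 1 / 2)) Gh)
    (hz : ∀ i x, inner ℝ (b i) ((Qh - Q) x) = inner ℝ (z i) x)
    (hz' : ∀ i x, inner ℝ (b i) ((Ch - G ∘L S) x) = inner ℝ (z' i) x) (hδ0 : 0 ≤ δ)
    (hδ : ∀ s : Finset ι, ∑ i ∈ s, ‖z i‖ ^ 2 / (a i + ε) ≤ δ ^ 2)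
    (hδ' : ∀ s : Finset ι, ∑ i ∈ s, ‖z' i‖ ^ 2 / (a i + ε) ≤ δ ^ 2) :
    ‖opPow (Qh + ε • ContinuousLinearMap.id ℝ H) (-(1 / 2)) ∘L Ch - Gh ∘L S‖
      ≤ (1 + L ^ β * ‖S‖) * ((1 + δ * (√ε)⁻¹) * δ)
        + L ^ (β + 1 / 2 - min (β + 1 / 2) 1) * ‖S‖ * ε ^ min (β + 1 / 2) 1 := by
  have hA := hQh.add_smul_id ε
  have hB := hQ.add_smul_id ε
  set A := Qh + ε • ContinuousLinearMap.id ℝ H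
  set B := Q + ε • ContinuousLinearMap.id ℝ H
  have hγ : ∀ i, ε ≤ a i + ε := fun i => by linarith [ha i]
  have hα : ∀ k, ε ≤ ν k + ε := fun k => by linarith [hν k]
  have hγ0 : ∀ i, 0 < a i + ε := fun i => hε.trans_le (hγ i)
  have hα0 : ∀ k, 0 < ν k + ε := fun k => hε.trans_le (hα k)
  have hpow : ∀ x : ℝ, 0 ≤ x → x ^ (-(1 / 2) : ℝ) = (√x)⁻¹ := fun x hx => by
    rw [Real.rpow_neg hx, Real.sqrt_eq_rpow]
  have hinv : ∀ x : ℝ, ε ≤ x → |(√x)⁻¹| ≤ (√ε)⁻¹ := fun x hx => by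
    rw [abs_of_nonneg (by positivity)]
    exact inv_anti₀ (Real.sqrt_pos.2 hε) (Real.sqrt_le_sqrt hx)
  have hAi : IsDiag e (fun k => (√(ν k + ε))⁻¹) (opPow A (-(1 / 2))) := by
    have h := hA.opPow (s := -(1 / 2)) (c := (√ε)⁻¹) fun k => by
      rw [hpow _ (hα0 k).le]
      exact hinv _ (hα k)
    simpa only [hpow _ (hα0 _).le] using h
  set Ai := opPow A (-(1 / 2))
  obtain ⟨Bi, hBi⟩ := exists_isDiag b (f := fun i => (√(a i + ε))⁻¹) fun i => hinv _ (hγ i)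
  obtain ⟨Bh, hBh⟩ := exists_isDiag b (f := fun i => √(a i + ε)) (c := √(L + ε)) fun i => by
    rw [abs_of_nonneg (Real.sqrt_nonneg _)]
    exact Real.sqrt_le_sqrt (by linarith [haL i])
  have hAB : A - B = Qh - Q := by simp [A, B]
  rw [← hAB] at hz
  have hD := norm_invSqrt_comp_le hBi hγ0 hz hδ0 hδ
  have hD' := norm_invSqrt_comp_le hBi hγ0 hz' hδ0 hδ'
  have ht := norm_invSqrt_comp_sqrt_le hA hAi hB hBi hBh hε hα hγ hD
  set t := 1 + δ * (√ε)⁻¹ with ht_def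
  have ht0 : 0 ≤ t := by positivity
  have hBB : Bh ∘L Bi = ContinuousLinearMap.id ℝ H := (hBh.comp hBi).unique isDiag_id
    fun i => mul_inv_cancel₀ (Real.sqrt_pos.2 (hγ0 i)).ne'
  have hAv : ∀ v, Ai v = (Ai ∘L Bh) (Bi v) := fun v => by
    have := congrArg (fun T : H →L[ℝ] H => T v) hBB
    simp only [ContinuousLinearMap.comp_apply, ContinuousLinearMap.id_apply] at this ⊢
    rw [this]
  have htv : ∀ v, ‖Ai v‖ ≤ t * ‖Bi v‖ := fun v => by
    rw [hAv]
    exact ((Ai ∘L Bh).le_opNorm _).trans (by gcongr)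
  have e1 : ‖Ai ∘L (Ch - G ∘L S)‖ ≤ t * δ := by
    have : Ai ∘L (Ch - G ∘L S) = (Ai ∘L Bh) ∘L (Bi ∘L (Ch - G ∘L S)) := by
      ext x
      exact hAv _
    rw [this]
    refine (ContinuousLinearMap.opNorm_comp_le _ _).trans ?_
    gcongr
  have e2 : ‖(Ai - Bi) ∘L G‖ ≤ L ^ β * t * δ := by
    refine norm_invSqrt_sub_comp_le hA hAi hB hBi hG hα0 hγ0 hz hδ0 hδ htv ht0 (by positivity)
      fun i => ?_
    have h0 := ha i
    rw [abs_of_nonneg (by positivity), add_comm 1 β, Real.rpow_add_of_nonneg h0 hβ.le zero_le_one,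
      Real.rpow_one]
    gcongr
    · exact haL i
    · linarith
  have e3 : ‖Bi ∘L G - Gh‖ ≤ L ^ (β + 1 / 2 - min (β + 1 / 2) 1) * ε ^ min (β + 1 / 2) 1 :=
    ((hBi.comp hG).sub hGh).norm_le (by positivity) fun i =>
      abs_regularization_bias_le (ha i) (haL i) hε hβ
  have hsplit : Ai ∘L Ch - Gh ∘L S
      = Ai ∘L (Ch - G ∘L S) + ((Ai - Bi) ∘L G) ∘L S + (Bi ∘L G - Gh) ∘L S := by
    ext x
    simp
  rw [hsplit]
  calc _ ≤ t * δ + L ^ β * t * δ * ‖S‖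
        + L ^ (β + 1 / 2 - min (β + 1 / 2) 1) * ε ^ min (β + 1 / 2) 1 * ‖S‖ := by
        refine (norm_add₃_le).trans ?_
        gcongr
        · exact (ContinuousLinearMap.opNorm_comp_le _ _).trans (by gcongr)
        · exact (ContinuousLinearMap.opNorm_comp_le _ _).trans (by gcongr)
    _ = _ := by ring

/-- With `δ = M n^{-1/2} ε^{-1/(2α)}`, the quadratic term `δ² ε^{-1/2}` is of smaller order than
`n⁻¹ ε^{-1-1/(2α)}` because `α > 1`. -/
lemma one_add_mul_le_rate {α ε M δ : ℝ} {n : ℕ} (hα : 1 < α) (hε : 0 < ε) (hε1 : ε ≤ 1)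
    (hn : 0 < n) (hM : 0 ≤ M) (hδ : δ = M * ((n : ℝ) ^ (-(1 / 2) : ℝ) * ε ^ (-(1 / (2 * α))))) :
    (1 + δ * (√ε)⁻¹) * δ ≤ (M + M ^ 2) * ((n : ℝ)⁻¹ * ε ^ (-1 - 1 / (2 * α))
        + (n : ℝ) ^ (-(1 / 2) : ℝ) * ε ^ (-(1 / (2 * α)))) := by
  have hn0 : (0 : ℝ) < n := by exact_mod_cast hn
  set u := (n : ℝ) ^ (-(1 / 2) : ℝ) * ε ^ (-(1 / (2 * α))) with hu
  have hu0 : 0 ≤ u := by positivity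
  set v := (n : ℝ)⁻¹ * ε ^ (-1 - 1 / (2 * α)) with hv
  have hv0 : 0 ≤ v := by positivity
  have h1 : u ^ 2 * (√ε)⁻¹ ≤ v := by
    have h2 : u ^ 2 * (√ε)⁻¹ = (n : ℝ)⁻¹ * ε ^ (-(1 / α) - 1 / 2) := by
      rw [hu, mul_pow, ← Real.rpow_natCast, ← Real.rpow_natCast, ← Real.rpow_mul hn0.le,
        ← Real.rpow_mul hε.le, Real.sqrt_eq_rpow, ← Real.rpow_neg hε.le, mul_assoc,
        ← Real.rpow_add hε, ← Real.rpow_neg_one]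
      congr 2
      · norm_num
      · push_cast
        field_simp
        ring
    rw [h2, hv]
    gcongr ?_ * ?_
    refine Real.rpow_le_rpow_of_exponent_ge hε hε1 ?_
    have h3 : 1 / (2 * α) ≤ 1 / 2 := by
      gcongr
      linarith
    have h4 : 1 / α = 1 / (2 * α) + 1 / (2 * α) := by field_simp; ring
    linarith
  rw [hδ]
  calc (1 + M * u * (√ε)⁻¹) * (M * u) = M * u + M ^ 2 * (u ^ 2 * (√ε)⁻¹) := by ring
    _ ≤ M * u + M ^ 2 * v := by gcongr
    _ ≤ (M + M ^ 2) * (v + u) := by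
        linarith [mul_nonneg hM hv0, mul_nonneg (sq_nonneg M) hu0]

end Deterministic

section SampleCovariance

variable {S H : Type*} [NormedAddCommGroup H] [InnerProductSpace ℝ H] [CompleteSpace H]
  [RKHS ℝ H S ℝ]

lemma exists_isDiag_crossCovHat (n : ℕ) (x : ℕ → S) :
    ∃ (w : Set H) (e : HilbertBasis w ℝ H) (ν : w → ℝ),
      IsDiag e ν (crossCovHat H H n x x) ∧ ∀ k, 0 ≤ ν k := by
  let V : Submodule ℝ H :=
    Submodule.span ℝ ((fun i => feat H (x i) - meanHat H n x) '' (Finset.range n : Set ℕ))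
  have : FiniteDimensional ℝ V :=
    FiniteDimensional.span_of_finite ℝ ((Finset.range n).finite_toSet.image _)
  have hform : ∀ u v : H, inner ℝ u (crossCovHat H H n x x v) = (n : ℝ)⁻¹ *
      ∑ i ∈ Finset.range n, inner ℝ (feat H (x i) - meanHat H n x) v *
        inner ℝ u (feat H (x i) - meanHat H n x) := fun u v => by
    simp only [crossCovHat, smul_apply, sum_apply, rankOne_apply, inner_smul_right, inner_sum]
  obtain ⟨w, e, he⟩ := exists_isDiag_of_finiteDimensional (A := crossCovHat H H n x x)
    (fun u v => by
      rw [real_inner_comm, hform, hform]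
      congr 1
      refine Finset.sum_congr rfl fun i _ => ?_
      rw [mul_comm, real_inner_comm u, real_inner_comm _ v]) V fun v => by
      simp only [crossCovHat, smul_apply, sum_apply, rankOne_apply]
      exact V.smul_mem _ (V.sum_mem fun i hi => V.smul_mem _
        (Submodule.subset_span ⟨i, hi, rfl⟩))
  refine ⟨w, e, _, he, fun k => ?_⟩
  rw [hform]
  refine mul_nonneg (by positivity) (Finset.sum_nonneg fun i _ => ?_)
  rw [real_inner_comm (e k)]
  exact mul_self_nonneg _

end SampleCovariance

end GSIR

/-! ### The convergence rate -/

open GSIR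

theorem theorem2
    {Ω : Type*} [MeasurableSpace Ω] (P : Measure Ω) [IsProbabilityMeasure P]
    {p q : ℕ} (ΩX : Set (EuclideanSpace ℝ (Fin p))) (ΩY : Set (EuclideanSpace ℝ (Fin q)))
    -- the reproducing kernel Hilbert spaces on `ΩX` and `ΩY`
    (HX : Type*) [NormedAddCommGroup HX] [InnerProductSpace ℝ HX] [CompleteSpace HX]
    [RKHS ℝ HX ΩX ℝ]
    (HY : Type*) [NormedAddCommGroup HY] [InnerProductSpace ℝ HY] [CompleteSpace HY]
    [RKHS ℝ HY ΩY ℝ]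
    -- the random vectors and the i.i.d. sample
    (X : Ω → ΩX) (Y : Ω → ΩY) (hX : Measurable X) (hY : Measurable Y)
    (Xs : ℕ → Ω → ΩX) (Ys : ℕ → Ω → ΩY)
    (hindep : iIndepFun (fun i ω => (Xs i ω, Ys i ω)) P)
    (hident : ∀ i, IdentDistrib (fun ω => (Xs i ω, Ys i ω)) (fun ω => (X ω, Y ω)) P P)
    -- density modulo constants
    (hdenseX : GSIR.DenseModConst HX P X) (hdenseY : GSIR.DenseModConst HY P Y)
    -- bounded continuous kernels
    (hkX : GSIR.BoundedContinuousKernel HX) (hkY : GSIR.BoundedContinuousKernel HY)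
    -- `ran Σ_XY ⊆ ran Σ_XX`, and `Σ_XX† Σ_XY` is bounded
    (hrange : Set.range (GSIR.crossCov HX HY P X Y) ⊆ Set.range (GSIR.crossCov HX HX P X X))
    (hbdd : ∃ R : HY →L[ℝ] HX,
      GSIR.IsMPComp (GSIR.crossCov HX HX P X X) (GSIR.crossCov HX HY P X Y) R)
    -- nonlinear sufficient dimension reduction
    (hdom : GSIR.CondDominated P (fun ω => (X ω : EuclideanSpace ℝ (Fin p))) Y)
    (d : ℕ) (hsdr : GSIR.MinimalSDR HX P X Y d)
    (hrank : (GSIR.regOp HX HY P X Y : HY →ₗ[ℝ] HX).rank = (d : Cardinal))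
    -- eigenvalue decay and smoothness
    (α : ℝ) (hα : 1 < α) (hdecay : GSIR.EigenDecay (GSIR.crossCov HX HX P X X) α)
    (β : ℝ) (hβ : 0 < β)
    (hsmooth : ∃ S : HY →L[ℝ] HX,
      GSIR.crossCov HX HY P X Y = GSIR.opPow (GSIR.crossCov HX HX P X X) (1 + β) ∘L S)
    -- the regularization parameters
    (ε : ℕ → ℝ) (hε : ∀ n, 0 < ε n) (hε0 : Tendsto ε atTop (𝓝 0)) :
    -- `R' = Σ_XX^{†1/2} Σ_XY` is everywhere defined and bounded
    GSIR.IsMPComp (GSIR.opPow (GSIR.crossCov HX HX P X X) (1 / 2)) (GSIR.crossCov HX HY P X Y)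
      (GSIR.regOp HX HY P X Y) ∧
    GSIR.IsBigOp P
      (fun n ω => ‖GSIR.regOpHat HX HY n (ε n) (fun i => Xs i ω) (fun i => Ys i ω)
        - GSIR.regOp HX HY P X Y‖)
      (fun n => (n : ℝ) ^ (-(1 / 2) : ℝ) * ε n ^ (min (β + 1 / 2) 1 - 1)
        + ε n ^ min (β + 1 / 2) 1
        + (n : ℝ)⁻¹ * ε n ^ (-1 - 1 / (2 * α))
        + (n : ℝ) ^ (-(1 / 2) : ℝ) * ε n ^ (-(1 / (2 * α)))) := by
  have hsep := separableSpace_of_continuous_kernel hkX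
  obtain ⟨S, hS⟩ := hsmooth
  obtain ⟨w, b, a, hdiag, ha0, C₁, hC₁, hdim⟩ := hdecay.exists_isDiag hα
  have hcount : Countable w := countable_of_hilbertBasis b
  set Q := crossCov HX HX P X X with hQ
  set L := ‖Q‖ with hL
  have haL : ∀ i, a i ≤ L := fun i => (le_abs_self _).trans (hdiag.abs_le_norm i)
  have hbd : ∀ s : ℝ, 0 ≤ s → ∀ i, |a i ^ s| ≤ L ^ s := fun s hs i => by
    rw [abs_of_nonneg (Real.rpow_nonneg (ha0 i) _)]
    exact Real.rpow_le_rpow (ha0 i) (haL i) hs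
  have hhalf := hdiag.opPow (hbd (1 / 2) (by norm_num))
  have hG := hdiag.opPow (hbd (1 + β) (by positivity))
  have hGh := hdiag.opPow (hbd (β + 1 / 2) (by positivity))
  have hMP : IsMPComp (opPow Q (1 / 2)) (crossCov HX HY P X Y) (opPow Q (β + 1 / 2) ∘L S) := by
    rw [hS]
    refine isMPComp_of_isDiag hhalf hGh (fun i => ?_) (fun i hi => ?_) S
    · refine (hG i).trans ?_
      beta_reduce
      rw [← Real.rpow_add_of_nonneg (ha0 i) (by norm_num) (by positivity)]
      congr 2
      ring
    · have : a i = 0 := ((Real.rpow_eq_zero (ha0 i) (by norm_num)).1 hi)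
      rw [this, Real.zero_rpow (by positivity)]
  have hreg : regOp HX HY P X Y = opPow Q (β + 1 / 2) ∘L S := hMP.eq_mpComp
  rw [hreg]
  refine ⟨hMP, fun η hη => ?_⟩
  obtain ⟨DX, hDX0, hDX⟩ := exists_norm_feat_sub_le hkX (meanElt HX P X)
  obtain ⟨DY, hDY0, hDY⟩ := exists_norm_feat_sub_le hkY (meanElt HY P Y)
  -- `M` makes the two Markov bounds `4 D² C₁ / M²` at most `η / 2`.
  obtain ⟨M, hM0, hMX, hMY⟩ : ∃ M : ℝ, 0 < M ∧ 4 * DX ^ 2 * C₁ / M ^ 2 ≤ η / 2 ∧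
      4 * DY ^ 2 * C₁ / M ^ 2 ≤ η / 2 := by
    refine ⟨√(8 * (DX ^ 2 + DY ^ 2) * C₁ / η + 1), by positivity, ?_, ?_⟩ <;>
    · rw [Real.sq_sqrt (by positivity), div_le_iff₀ (by positivity)]
      have h1 : η / 2 * (8 * (DX ^ 2 + DY ^ 2) * C₁ / η + 1)
          = 4 * DX ^ 2 * C₁ + 4 * DY ^ 2 * C₁ + η / 2 := by field_simp; ring
      rw [h1]
      have h2 : 0 ≤ 4 * DX ^ 2 * C₁ := by positivity
      have h3 : 0 ≤ 4 * DY ^ 2 * C₁ := by positivity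
      linarith
  set c₁ := (1 + L ^ β * ‖S‖) * (M + M ^ 2) with hc₁
  set c₂ := L ^ (β + 1 / 2 - min (β + 1 / 2) 1) * ‖S‖ with hc₂
  have hc₁0 : 0 < c₁ := by positivity
  have hc₂0 : 0 ≤ c₂ := by positivity
  refine ⟨c₁ + c₂, by positivity, ?_⟩
  filter_upwards [eventually_gt_atTop 0, hε0.eventually (eventually_le_nhds one_pos)] with n hn hε1
  have hn0 : (0 : ℝ) < n := by exact_mod_cast hn
  have hεn := hε n
  set δ := M * ((n : ℝ) ^ (-(1 / 2) : ℝ) * ε n ^ (-(1 / (2 * α)))) with hδ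
  have hδ0 : 0 < δ := by positivity
  have hδsq : δ ^ 2 = M ^ 2 * ((n : ℝ)⁻¹ * ε n ^ (-(1 / α))) := by
    rw [hδ, mul_pow, mul_pow, ← Real.rpow_natCast ((n : ℝ) ^ _), ← Real.rpow_natCast (ε n ^ _),
      ← Real.rpow_mul hn0.le, ← Real.rpow_mul hεn.le, ← Real.rpow_neg_one]
    congr 3
    · norm_num
    · push_cast
      field_simp
  have hidX : ∀ i, IdentDistrib (fun ω => (Xs i ω, Xs i ω)) (fun ω => (X ω, X ω)) P P := fun i =>
    (hident i).comp (u := fun z => (z.1, z.1)) (by fun_prop)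
  have hindX : iIndepFun (fun i ω => (Xs i ω, Xs i ω)) P :=
    hindep.comp (fun _ z => (z.1, z.1)) fun _ => by fun_prop
  have hσ : ∀ i, inner ℝ (b i) (Q (b i)) = a i := fun i => by
    rw [hdiag i, inner_smul_right, real_inner_self_eq_norm_sq, b.orthonormal.1 i]
    norm_num
  have hγ : ∀ i, 0 < a i + ε n := fun i => by linarith [ha0 i]
  have hval : ∀ D : ℝ, 4 * D ^ 2 * (n : ℝ)⁻¹ * (C₁ * ε n ^ (-(1 / α))) / δ ^ 2
      = 4 * D ^ 2 * C₁ / M ^ 2 := fun D => by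
    have : ε n ^ (-(1 / α)) ≠ 0 := (Real.rpow_pos_of_pos hεn _).ne'
    rw [hδsq]
    field_simp
  -- The sample `(Xs, Xs)` of `(X, X)` makes `Σ̂_XX` a special case of `Σ̂_XY`.
  let zX : w → Ω → HX := fun i ω =>
    covError HX HX P X X n (fun j => Xs j ω) (fun j => Xs j ω) (b i)
  let zY : w → Ω → HY := fun i ω =>
    covError HX HY P X Y n (fun j => Xs j ω) (fun j => Ys j ω) (b i)
  have hPX : P {ω | ¬ ∀ s : Finset w, ∑ i ∈ s, ‖zX i ω‖ ^ 2 / (a i + ε n) ≤ δ ^ 2}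
      ≤ ENNReal.ofReal (η / 2) := by
    refine (measure_not_sum_le_le (c := 4 * DX ^ 2 * (n : ℝ)⁻¹)
      (fun i => aestronglyMeasurable_covError hkX hkX hidX n (b i)) hγ ha0 (by positivity)
      (fun i => ?_) (hdim (ε n) hεn hε1) (by positivity)).trans
      (ENNReal.ofReal_le_ofReal ((hval DX).trans_le hMX))
    rw [← hσ i]
    exact lintegral_norm_sq_covError_le hkX hkX hX hindX hidX hDX hn (b i)
  have hPY : P {ω | ¬ ∀ s : Finset w, ∑ i ∈ s, ‖zY i ω‖ ^ 2 / (a i + ε n) ≤ δ ^ 2}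
      ≤ ENNReal.ofReal (η / 2) := by
    refine (measure_not_sum_le_le (c := 4 * DY ^ 2 * (n : ℝ)⁻¹)
      (fun i => aestronglyMeasurable_covError hkX hkY hident n (b i)) hγ ha0 (by positivity)
      (fun i => ?_) (hdim (ε n) hεn hε1) (by positivity)).trans
      (ENNReal.ofReal_le_ofReal ((hval DY).trans_le hMY))
    rw [← hσ i]
    exact lintegral_norm_sq_covError_le hkX hkY hX hindep hident hDY hn (b i)
  have hsum : ENNReal.ofReal (η / 2) + ENNReal.ofReal (η / 2) = ENNReal.ofReal η := by
    rw [← ENNReal.ofReal_add (by positivity) (by positivity), add_halves]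
  rw [← hsum]
  refine (measure_mono ?_).trans ((measure_union_le _ _).trans (add_le_add hPX hPY))
  intro ω hω
  by_contra hnot
  simp only [Set.mem_union, Set.mem_ofPred_eq, not_or, not_not] at hnot
  obtain ⟨hX', hY'⟩ := hnot
  rw [Set.mem_ofPred_eq] at hω
  refine absurd hω (not_lt.2 ?_)
  rw [abs_of_nonneg (norm_nonneg _)]
  obtain ⟨w', e, ν, he, hν⟩ := exists_isDiag_crossCovHat (H := HX) n fun i => Xs i ω
  have hmain := norm_opPow_comp_sub_le (S := S) hdiag he ha0 hν haL (norm_nonneg Q) hβ hεn hG hGh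
    (z := fun i => zX i ω) (z' := fun i => zY i ω)
    (fun i x => inner_crossCovHat_sub_apply hkX hkX hX hX hn _ _ (b i) x)
    (fun i x => by
      rw [← hS]
      exact inner_crossCovHat_sub_apply hkX hkY hX hY hn _ _ (b i) x) hδ0.le hX' hY'
  refine hmain.trans ?_
  have hrate := one_add_mul_le_rate hα hεn hε1 hn hM0.le hδ
  set r₁ := (n : ℝ) ^ (-(1 / 2) : ℝ) * ε n ^ (min (β + 1 / 2) 1 - 1)
  set r₂ := ε n ^ min (β + 1 / 2) 1
  set r₃ := (n : ℝ)⁻¹ * ε n ^ (-1 - 1 / (2 * α))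
  set r₄ := (n : ℝ) ^ (-(1 / 2) : ℝ) * ε n ^ (-(1 / (2 * α)))
  have hr₁ : 0 ≤ r₁ := by positivity
  have hr₂ : 0 ≤ r₂ := by positivity
  have hr₃ : 0 ≤ r₃ := by positivity
  have hr₄ : 0 ≤ r₄ := by positivity
  calc _ ≤ (1 + L ^ β * ‖S‖) * ((M + M ^ 2) * (r₃ + r₄)) + c₂ * r₂ := by gcongr
    _ = c₁ * (r₃ + r₄) + c₂ * r₂ := by rw [hc₁]; ring
    _ ≤ c₁ * (r₁ + r₂ + r₃ + r₄) + c₂ * (r₁ + r₂ + r₃ + r₄) := by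
        gcongr <;> linarith
    _ = _ := by ring

end
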